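/- Consider the probabilistic asynchronous $\pi$-calculus with booleans, conditionals and an additional priority choice. The semantics of a process is a probabilistic automaton: in each state a transition group (a discrete probability distribution on pairs (action, next state)) is selected nondeterministically by an adversary, and the transition within the group is selected probabilistically. In a probabilistic choice $\sum_i p_i\,\alpha_i.P_i$ all branches form one group; an output may synchronize with the matching inputs of a group of a parallel process, the other transitions of that group being kept; a restriction $\nu y$ drops the transitions whose actions have $y$ as a free name and renormalizes the probabilities of the remaining ones. In a priority choice $x(b).P \triangleright \tau.Q$ the first branch is selected if its prefix is enabled, i.e. if an unguarded output on $x$ is available in the rest of the system, and the second branch $\tau.Q$ can be selected only if no such output is available. Consider the process $\nu x_0\,\nu x_1\,(P_0 \mid P_1)$, where, for $i\in\{0,1\}$ and with $\oplus$ the sum modulo $2$, $$P_i \;=\; \bar x_i\langle \mathbf t\rangle \;\mid\; \mathit{rec}_X\Bigl(\tfrac12\,\tau.B_{i,i} + \tfrac12\,\tau.B_{i,i\oplus 1}\Bigr),$$ $$B_{i,j} \;=\; x_j(b).\ \mathit{if}\ b\ \mathit{then}\ \bigl(x_{j\oplus1}(b).(\bar o_i\langle i\rangle \mid \bar x_j\langle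 \mathbf f\rangle)\ \triangleright\ \tau.(\bar x_j\langle \mathbf t\rangle \mid X)\bigr)\ \mathit{else}\ \bar o_i\langle i\oplus 1\rangle .$$ A random draw $(i,j)$ is the $\tau$-transition of $P_i$ that selects the branch $B_{i,j}$ of the blind choice $\tfrac12\,\tau.B_{i,i} + \tfrac12\,\tau.B_{i,i\oplus1}$. An adversary selects, at each node of the unfolding tree of the automaton (hence depending on the whole history, including the earlier random choices), one of the transition groups allowed in the state of that node, whenever there is one; the executions under the adversary carry the probability measure that gives to the set of all executions extending a finite path the product of the transition probabilities along this path. Then, for every $n\ge 2$ and under every adversary, the probability of the executions of $\nu x_0\,\nu x_1\,(P_0\mid P_1)$ that contain at least $n$ random draws is at most $1/2^{\,n-2}$. -/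

import Mathlib

open MeasureTheory ProbabilityTheory
open scoped ENNReal

/-! ## Probabilistic automata, adversaries, executions -/

/-- A probabilistic automaton on states `S` and actions `A`: an initial state, and for every state
the set of its transition groups. A transition group is a discrete probability distribution on
`A × S`; deadlock is the absence of transition groups. -/
structure ProbAutomaton (S A : Type) where
  init : S
  trans : S → Set (PMF (A × S))

/-- The nodes of the unfolding tree: the root, and for every node `n` a child for each transition
`(a, s)` of each group `g`, labeled by the state `s`. A node determines the path leading to it. -/
inductive Node (S A : Type) : Type
  | root
  | child (n : Node S A) (g : PMF (A × S)) (a : A) (s : S)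

instance (S A : Type) : MeasurableSpace (Node S A) := ⊤

namespace ProbAutomaton

variable {S A : Type}

/-- The state that labels a node. -/
def state (M : ProbAutomaton S A) : Node S A → S
  | Node.root => M.init
  | Node.child _ _ _ s => s

/-- An adversary selects at every node one of the transition groups that are allowed in the state of
the node; it selects nothing only at a node whose state is deadlocked. -/
structure Adversary (M : ProbAutomaton S A) where
  choose : Node S A → Option (PMF (A × S))
  mem_trans : ∀ n g, choose n = some g → g ∈ M.trans (M.state n)
  eq_none : ∀ n, choose n = none → M.trans (M.state n) = ∅

namespace Adversary

variable {M : ProbAutomaton S A}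

/-- One step of the execution tree: from a node to its children within the selected group, with the
probabilities of that group. A finite maximal path is continued by repeating its last node. -/
noncomputable def next (ζ : M.Adversary) (n : Node S A) : PMF (Node S A) :=
  match ζ.choose n with
  | none => PMF.pure n
  | some g => g.map fun a => n.child g a.1 a.2

/-- The step of the execution tree as a Markov kernel from the first `t + 1` nodes of a path to
the node that comes next. -/
noncomputable def stepKernel (ζ : M.Adversary) (t : ℕ) :
    Kernel (Finset.Iic t → Node S A) (Node S A) :=
  Kernel.comap (⟨fun n => (ζ.next n).toMeasure, measurable_from_top⟩ : Kernel (Node S A) (Node S A))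
    (fun ω => ω ⟨t, Finset.mem_Iic.2 le_rfl⟩) (measurable_pi_apply _)

instance (ζ : M.Adversary) (t : ℕ) : IsMarkovKernel (ζ.stepKernel t) :=
  ⟨fun ω => PMF.toMeasure.isProbabilityMeasure (ζ.next (ω ⟨t, Finset.mem_Iic.2 le_rfl⟩))⟩

/-- The probability measure on the executions under `ζ`, an execution being the sequence of the
nodes that it visits, from the root on. The cone of the executions that extend a finite path has as
its measure the product of the probabilities along that path. -/
noncomputable def execMeasure (ζ : M.Adversary) : Measure (ℕ → Node S A) :=
  Kernel.traj (X := fun _ => Node S A) ζ.stepKernel 0 (fun _ => Node.root)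

end Adversary

end ProbAutomaton

/-! ## The probabilistic asynchronous π-calculus with a priority choice

Bound names and process variables are de Bruijn indices, so that alpha-convertible processes
are equal. -/

/-- Names. `var k` is the name bound by the `k`-th enclosing binder (or a free name if there is no
such binder); `chan k` are global channel names; `bool b` are the values **t** and **f**; `num k`
are the values that name a process. -/
inductive Name : Type
  | var (k : ℕ)
  | chan (k : ℕ)
  | bool (b : Bool)
  | num (k : ℕ)
  deriving DecidableEq

namespace Name

/-- Simultaneous substitution of names for the indices. -/
def subst (σ : ℕ → Name) : Name → Name
  | var k => σ k
  | x => x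

/-- Passage under one more name binder. -/
def shift : Name → Name := subst fun k => var (k + 1)

/-- Passage out of a name binder, for names other than `var 0`. -/
def lower : Name → Name := subst fun k => var (k - 1)

/-- The substitution `σ` under one more name binder. -/
def liftSubst (σ : ℕ → Name) : ℕ → Name
  | 0 => var 0
  | k + 1 => (σ k).shift

/-- The substitution that replaces the innermost bound name by `y` and removes its binder. -/
def inst (y : Name) : ℕ → Name
  | 0 => y
  | k + 1 => var k

/-- The substitution that exchanges the two innermost bound names. -/
def swap : ℕ → Name
  | 0 => var 1
  | 1 => var 0
  | k + 2 => var (k + 2)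

end Name

/-- A random draw `(i, j)`: process `i` selects channel `j`. Arithmetic in `Fin 2` is modulo 2. -/
abbrev Draw : Type := Fin 2 × Fin 2

/-- Prefixes: the input `x(y)`, which binds a name in its continuation, and the silent prefix. A
silent prefix may carry the random draw it stands for, so that draws can be told from the other
silent steps. -/
inductive Prefix : Type
  | inp (x : Name)
  | tau (d : Option Draw)

/-- Actions: input `x(y)`, free output, bound output `x̄(y)`, and silent action. Input and bound
output bind a name in the process that is reached. -/
inductive Act : Type
  | inp (x : Name)
  | out (x y : Name)
  | bout (x : Name)
  | tau (d : Option Draw)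

namespace Prefix

def subst (σ : ℕ → Name) : Prefix → Prefix
  | inp x => inp (x.subst σ)
  | tau d => tau d

/-- The substitution `σ`, as it acts on the continuation of the prefix. -/
def liftSubst (σ : ℕ → Name) : Prefix → ℕ → Name
  | inp _ => Name.liftSubst σ
  | tau _ => σ

def toAct : Prefix → Act
  | inp x => Act.inp x
  | tau d => Act.tau d

end Prefix

namespace Act

/-- The name `x` occurs free in the action. -/
def HasFree (x : Name) : Act → Prop
  | inp y => x = y
  | out y z => x = y ∨ x = z
  | bout y => x = y
  | tau _ => False

def lower : Act → Act
  | inp x => inp x.lower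
  | out x y => out x.lower y.lower
  | bout x => bout x.lower
  | tau d => tau d

end Act

/-- Processes.
* `nil`: inaction, the empty sum;
* `out x y`: asynchronous output of `y` on `x`;
* `sum w α P`: the probabilistic choice `∑ i, w i · α i . P i` (a branch of weight 0 is never
  a transition, it is as if it were absent);
* `nu P`: restriction, which binds a name in `P`;
* `par P Q`: parallel composition;
* `pvar k`, `recu P`: process variables and recursion, `recu P` binds a process variable in `P`;
* `ite b P Q`: `if b then P else Q`;
* `prio x P Q`: the priority choice between `x(y).P`, where `y` is bound in `P`, and `τ.Q`: the
  first branch is selected if its prefix is enabled, the second one otherwise. -/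
inductive Proc : Type
  | nil
  | out (x y : Name)
  | sum {m : ℕ} (w : PMF (Fin m)) (α : Fin m → Prefix) (P : Fin m → Proc)
  | nu (P : Proc)
  | par (P Q : Proc)
  | pvar (k : ℕ)
  | recu (P : Proc)
  | ite (b : Name) (P Q : Proc)
  | prio (x : Name) (P Q : Proc)

namespace Proc

/-- Simultaneous substitution of names for the free indices. -/
def subst : (ℕ → Name) → Proc → Proc
  | _, nil => nil
  | σ, out x y => out (x.subst σ) (y.subst σ)
  | σ, sum w α P => sum w (fun i => (α i).subst σ) (fun i => (P i).subst ((α i).liftSubst σ))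
  | σ, nu P => nu (P.subst (Name.liftSubst σ))
  | σ, par P Q => par (P.subst σ) (Q.subst σ)
  | _, pvar k => pvar k
  | σ, recu P => recu (P.subst σ)
  | σ, ite b P Q => ite (b.subst σ) (P.subst σ) (Q.subst σ)
  | σ, prio x P Q => prio (x.subst σ) (P.subst (Name.liftSubst σ)) (Q.subst σ)

/-- Passage under one more name binder. -/
def shift : Proc → Proc := subst fun k => Name.var (k + 1)

/-- Passage into the scope of the name that the action binds, if it binds one. -/
def under : Act → Proc → Proc
  | Act.inp _, P => P.shift
  | Act.bout _, P => P.shift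
  | _, P => P

/-- Passage of a process into the scope of a prefix. -/
def underPrefix (α : Prefix) (P : Proc) : Proc := P.under α.toAct

/-- Renaming of the free process variables. -/
def prename : (ℕ → ℕ) → Proc → Proc
  | _, nil => nil
  | _, out x y => out x y
  | ρ, sum w α P => sum w α (fun i => (P i).prename ρ)
  | ρ, nu P => nu (P.prename ρ)
  | ρ, par P Q => par (P.prename ρ) (Q.prename ρ)
  | ρ, pvar k => pvar (ρ k)
  | ρ, recu P => recu (P.prename fun k => Nat.casesOn k 0 fun j => ρ j + 1)
  | ρ, ite b P Q => ite b (P.prename ρ) (Q.prename ρ)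
  | ρ, prio x P Q => prio x (P.prename ρ) (Q.prename ρ)

/-- Simultaneous, capture-avoiding substitution of processes for the free process variables. -/
def psubst : (ℕ → Proc) → Proc → Proc
  | _, nil => nil
  | _, out x y => out x y
  | θ, sum w α P => sum w α (fun i => (P i).psubst fun k => (θ k).underPrefix (α i))
  | θ, nu P => nu (P.psubst fun k => (θ k).shift)
  | θ, par P Q => par (P.psubst θ) (Q.psubst θ)
  | θ, pvar k => θ k
  | θ, recu P => recu (P.psubst fun k => Nat.casesOn k (pvar 0) fun j => (θ j).prename Nat.succ)
  | θ, ite b P Q => ite b (P.psubst θ) (Q.psubst θ)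
  | θ, prio x P Q => prio x (P.psubst fun k => (θ k).shift) (Q.psubst θ)

/-- The body `P` of a recursion, with the recursive process itself for the variable it binds. -/
def unfold (P : Proc) : Proc := P.psubst fun k => Nat.casesOn k (recu P) pvar

/-- All the occurrences of the process variable `k` are prefixed. -/
def Guarded : ℕ → Proc → Prop
  | _, nil => True
  | _, out _ _ => True
  | _, sum _ _ _ => True
  | k, nu P => P.Guarded k
  | k, par P Q => P.Guarded k ∧ Q.Guarded k
  | k, pvar j => j ≠ k
  | k, recu P => P.Guarded (k + 1)
  | k, ite _ P Q => P.Guarded k ∧ Q.Guarded k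
  | _, prio _ _ _ => True

/-- Structural congruence: the least congruence that contains the commutativity of the parallel
operator, the unfolding of recursion, and the rules of the conditional. Recursion is formed on
guarded bodies only. -/
inductive Cong : Proc → Proc → Prop
  | refl (P) : Cong P P
  | symm {P Q} : Cong P Q → Cong Q P
  | trans {P Q R} : Cong P Q → Cong Q R → Cong P R
  | par_comm (P Q) : Cong (par P Q) (par Q P)
  | recu_unfold (P) : Cong (recu P) P.unfold
  | ite_true (P Q) : Cong (ite (Name.bool true) P Q) P
  | ite_false (P Q) : Cong (ite (Name.bool false) P Q) Q
  | sum {m : ℕ} (w : PMF (Fin m)) (α) {P Q : Fin m → Proc} :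
      (∀ i, Cong (P i) (Q i)) → Cong (sum w α P) (sum w α Q)
  | nu {P Q} : Cong P Q → Cong (nu P) (nu Q)
  | par {P P' Q Q'} : Cong P P' → Cong Q Q' → Cong (par P Q) (par P' Q')
  | recu {P Q} : P.Guarded 0 → Q.Guarded 0 → Cong P Q → Cong (recu P) (recu Q)
  | ite (b) {P P' Q Q'} : Cong P P' → Cong Q Q' → Cong (ite b P Q) (ite b P' Q')
  | prio (x) {P P' Q Q'} : Cong P P' → Cong Q Q' → Cong (prio x P Q) (prio x P' Q')

/-- The process offers an output on `x`: it has an unguarded output on that name. -/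
inductive Offers : Proc → Name → Prop
  | out (x y) : Offers (out x y) x
  | nu {P x} : Offers P x.shift → Offers (nu P) x
  | par_left {P Q x} : Offers P x → Offers (par P Q) x
  | par_right {P Q x} : Offers Q x → Offers (par P Q) x
  | recu {P x} : Offers P.unfold x → Offers (recu P) x
  | ite_true {P Q x} : Offers P x → Offers (ite (Name.bool true) P Q) x
  | ite_false {P Q x} : Offers Q x → Offers (ite (Name.bool false) P Q) x

/-- A transition of `P` that `P | Q` inherits. -/
def parTarget (Q : Proc) (a : Act × Proc) : Act × Proc := (a.1, par a.2 (Q.under a.1))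

/-- A transition of `P` that `ν P` inherits. -/
def resTarget : Act × Proc → Act × Proc
  | (Act.inp x, P) => (Act.inp x.lower, nu (P.subst Name.swap))
  | (Act.bout x, P) => (Act.bout x.lower, nu (P.subst Name.swap))
  | (μ, P) => (μ.lower, nu P)

/-- A transition of `Q` in the group of `P | Q` in which `P` offers `x̄y` and then becomes `P'`. -/
def comTarget (P P' : Proc) (x y : Name) : Act × Proc → Act × Proc
  | (Act.inp z, Q) => if z = x then (Act.tau none, par P' (Q.subst (Name.inst y)))
      else (Act.inp z, par P.shift Q)
  | (μ, Q) => (μ, par (P.under μ) Q)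

/-- A transition of `Q` in the group of `P | Q` in which `P` offers a private name on `x` and then
becomes `P'`. -/
def closeTarget (P P' : Proc) (x : Name) : Act × Proc → Act × Proc
  | (Act.inp z, Q) => if z = x then (Act.tau none, nu (par P' Q))
      else (Act.inp z, par P.shift Q)
  | (μ, Q) => (μ, par (P.under μ) Q)

/-- `Step E P g`: `g` is a transition group of `P` when `E` is the set of the names on which the
rest of the system offers an output. The set `E` only matters for the second branch of a priority
choice, which can be selected only if no output is available for the first one.

In `res` the transitions on the restricted name are dropped and the probability is redistributed
among the others (`PMF.filter` normalizes). -/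
inductive Step : Set Name → Proc → PMF (Act × Proc) → Prop
  | sum (E) {m : ℕ} (w : PMF (Fin m)) (α P) :
      Step E (sum w α P) (w.map fun i => ((α i).toAct, P i))
  | out (E x y) : Step E (out x y) (PMF.pure (Act.out x y, nil))
  | prio_inp (E x P Q) : Step E (prio x P Q) (PMF.pure (Act.inp x, P))
  | prio_tau {E x} (P Q) : x ∉ E → Step E (prio x P Q) (PMF.pure (Act.tau none, Q))
  | opn {E P P' x} : x ≠ Name.var 0 →
      Step (Name.shift '' E) P (PMF.pure (Act.out x (Name.var 0), P')) →
      Step E (nu P) (PMF.pure (Act.bout x.lower, P'))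
  | res {E P g} (h : ∃ a ∈ {a : Act × Proc | ¬ a.1.HasFree (Name.var 0)}, a ∈ g.support) :
      Step (Name.shift '' E) P g →
      Step E (nu P) ((g.filter {a : Act × Proc | ¬ a.1.HasFree (Name.var 0)} h).map resTarget)
  | par {E P Q g} : Step (E ∪ {x | Q.Offers x}) P g →
      Step E (par P Q) (g.map (parTarget Q))
  | com {E P P' Q g x y} :
      Step (E ∪ {x | Q.Offers x}) P (PMF.pure (Act.out x y, P')) →
      Step (E ∪ {x | P.Offers x}) Q g →
      Step E (par P Q) (g.map (comTarget P P' x y))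
  | close {E P P' Q g x} :
      Step (E ∪ {x | Q.Offers x}) P (PMF.pure (Act.bout x, P')) →
      Step (E ∪ {x | P.Offers x}) Q g →
      Step E (par P Q) (g.map (closeTarget P P' x))
  | cong {E P P' g} (f : Act × Proc → Proc) : Cong P P' → Step E P' g →
      (∀ a ∈ g.support, Cong a.2 (f a)) →
      Step E P (g.map fun a => (a.1, f a))

/-- The probabilistic automaton of a process. -/
def automaton (P : Proc) : ProbAutomaton Proc Act where
  init := P
  trans := fun Q => {g | Step ∅ Q g}

/-- The process `α.P`. -/
noncomputable def pre (α : Prefix) (P : Proc) : Proc :=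
  sum (PMF.pure (0 : Fin 1)) (fun _ => α) (fun _ => P)

end Proc

/-! ## The election algorithm -/

namespace Election

open Proc

/-- The channels `x₀` and `x₁` in the scope of `ν x₀ ν x₁`. -/
def x : Fin 2 → Name
  | 0 => Name.var 1
  | 1 => Name.var 0

/-- The channel `o i` on which process `i` announces the leader. -/
def o (i : Fin 2) : Name := Name.chan i

/-- What process `i` does after it has selected channel `j`, the process variable `X` being `pvar 0`:
`x_j(b). if b then (x_{j⊕1}(b).(ō_i⟨i⟩ | x̄_j⟨f⟩) or else τ.(x̄_j⟨t⟩ | X)) else ō_i⟨i⊕1⟩`,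
where "or else" is the priority choice. -/
noncomputable def branch (i j : Fin 2) : Proc :=
  pre (Prefix.inp (x j)) <|
    ite (Name.var 0)
      (prio (x (j + 1)).shift
        (par (out (o i) (Name.num i)) (out (x j).shift.shift (Name.bool false)))
        (par (out (x j).shift (Name.bool true)) (pvar 0)))
      (out (o i) (Name.num ((i + 1 : Fin 2) : ℕ)))

/-- The process `P_i = x̄_i⟨t⟩ | rec_X (1/2 τ. branch i i + 1/2 τ. branch i (i ⊕ 1))`. -/
noncomputable def node (i : Fin 2) : Proc :=
  par (out (x i) (Name.bool true))
    (recu (sum (PMF.uniformOfFintype (Fin 2))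
      (fun k => Prefix.tau (some (i, i + k))) (fun k => branch i (i + k))))

/-- The network `ν x₀ ν x₁ (P₀ | P₁)`. -/
noncomputable def network : Proc := nu (nu (par (node 0) (node 1)))

/-- The number of random draws on the path that leads to a node. -/
def draws : Node Proc Act → ℕ
  | Node.root => 0
  | Node.child n _ (Act.tau (some _)) _ => draws n + 1
  | Node.child n _ _ _ => draws n

end Election

/-! ## Substitutions -/

namespace Name

/-! Suppose that a process draws while the other one is committed to a channel `j`, waiting for it
or holding it. With probability 1/2 the draw is `j` too. Then one process gets `j`, the other can
only wait for `j`, and the token of the remaining channel stays free. Priority forbids the holder to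
release, so it takes this token, announces itself and leaves **f** on `j`: no draw follows. A
release is possible only if both channels are held, and the process that releases then redraws
against one that is still committed or has already won; in the latter case this draw is the last
one. So every draw but the first ends the drawing with conditional probability at least 1/2,
whatever the adversary does. To see `n` draws, the draws number 2 to `n - 1` must all fail to end
it, which gives `1 / 2 ^ (n - 2)`.

This is made precise by ranks of multisets of components. The reachable multisets lie in a finite
list, closed under silent steps and draws (`ranked_comm`, `ranked_release`, `ranked_draw`, by
evaluation). The resulting potential `value` is a supermartingale under every adversary
(`lintegral_value_le`), and `execMeasure_exists_le` concludes by Markov's inequality.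

The remaining work is to find all the transition groups of a state, although structural congruence
may rewrite it arbitrarily. Congruent processes evaluate to the same head with congruent components
(`WCong.evLE`). Hence the rules can be inverted for the parallel composition (`Comp.trans`) and then
through the two restrictions (`Net.group`). -/

theorem subst_subst (σ τ : ℕ → Name) (x : Name) :
    (x.subst σ).subst τ = x.subst fun k => (σ k).subst τ := by
  cases x <;> rfl

theorem subst_var (x : Name) : x.subst var = x := by
  cases x <;> rfl

theorem liftSubst_var : liftSubst var = var := by
  funext k; cases k <;> rfl

theorem liftSubst_comp (σ τ : ℕ → Name) :
    (fun k => (liftSubst σ k).subst (liftSubst τ)) = liftSubst fun k => (σ k).subst τ := by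
  funext k
  cases k with
  | zero => rfl
  | succ k => simp only [liftSubst, shift, subst_subst]; rfl

theorem shift_subst_liftSubst (σ : ℕ → Name) (x : Name) :
    x.shift.subst (liftSubst σ) = (x.subst σ).shift := by
  simp only [shift, subst_subst]; rfl

theorem shift_subst_inst (x y : Name) : x.shift.subst (inst y) = x := by
  rw [shift, subst_subst]; exact subst_var x

end Name

namespace Proc

theorem prefix_liftSubst_var (α : Prefix) : α.liftSubst Name.var = Name.var := by
  cases α
  · exact Name.liftSubst_var
  · rfl

theorem prefix_liftSubst_comp (α : Prefix) (σ τ : ℕ → Name) :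
    (fun k => (α.liftSubst σ k).subst ((α.subst σ).liftSubst τ)) =
      α.liftSubst fun k => (σ k).subst τ := by
  cases α
  · exact Name.liftSubst_comp σ τ
  · rfl

theorem prefix_subst_subst (α : Prefix) (σ τ : ℕ → Name) :
    (α.subst σ).subst τ = α.subst fun k => (σ k).subst τ := by
  cases α <;> simp [Prefix.subst, Name.subst_subst]

theorem prefix_subst_var (α : Prefix) : α.subst Name.var = α := by
  cases α <;> simp [Prefix.subst, Name.subst_var]

theorem subst_subst (P : Proc) (σ τ : ℕ → Name) :
    (P.subst σ).subst τ = P.subst fun k => (σ k).subst τ := by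
  induction P generalizing σ τ <;>
    simp_all [subst, Name.subst_subst, Name.liftSubst_comp, prefix_subst_subst,
      prefix_liftSubst_comp]

theorem subst_var (P : Proc) : P.subst Name.var = P := by
  induction P <;>
    simp_all [subst, Name.subst_var, Name.liftSubst_var, prefix_liftSubst_var, prefix_subst_var]

theorem shift_subst_liftSubst (P : Proc) (σ : ℕ → Name) :
    P.shift.subst (Name.liftSubst σ) = (P.subst σ).shift := by
  simp only [shift, subst_subst]; rfl

theorem shift_subst_inst (P : Proc) (y : Name) : P.shift.subst (Name.inst y) = P := by
  rw [shift, subst_subst]; exact subst_var P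

theorem underPrefix_subst (α : Prefix) (P : Proc) (σ : ℕ → Name) :
    (P.underPrefix α).subst (α.liftSubst σ) = (P.subst σ).underPrefix (α.subst σ) := by
  cases α
  · exact shift_subst_liftSubst P σ
  · rfl

theorem prename_subst (P : Proc) (ρ : ℕ → ℕ) (σ : ℕ → Name) :
    (P.prename ρ).subst σ = (P.subst σ).prename ρ := by
  induction P generalizing ρ σ <;> simp_all [subst, prename]

theorem shift_prename (P : Proc) (ρ : ℕ → ℕ) : P.shift.prename ρ = (P.prename ρ).shift :=
  (prename_subst P ρ _).symm

theorem underPrefix_prename (α : Prefix) (P : Proc) (ρ : ℕ → ℕ) :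
    (P.underPrefix α).prename ρ = (P.prename ρ).underPrefix α := by
  cases α
  · exact shift_prename P ρ
  · rfl

/-- A renaming of the process variables under one more binder. -/
def liftRename (ρ : ℕ → ℕ) : ℕ → ℕ := fun k => Nat.casesOn k 0 fun j => ρ j + 1

/-- A substitution of processes under one more binder of a process variable. -/
def liftProc (θ : ℕ → Proc) : ℕ → Proc :=
  fun k => Nat.casesOn k (pvar 0) fun j => (θ j).prename Nat.succ

/-- The substitution that replaces the innermost bound process variable. -/
def instProc (P : Proc) : ℕ → Proc := fun k => Nat.casesOn k P pvar

theorem prename_recu (ρ : ℕ → ℕ) (P : Proc) :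
    (recu P).prename ρ = recu (P.prename (liftRename ρ)) := rfl

theorem psubst_recu (θ : ℕ → Proc) (P : Proc) :
    (recu P).psubst θ = recu (P.psubst (liftProc θ)) := rfl

theorem unfold_eq (P : Proc) : P.unfold = P.psubst (instProc (recu P)) := rfl

theorem prename_prename (P : Proc) (ρ ρ' : ℕ → ℕ) :
    (P.prename ρ).prename ρ' = P.prename fun k => ρ' (ρ k) := by
  induction P generalizing ρ ρ' with
  | recu P ih =>
    simp only [prename_recu, ih]
    congr 2
    funext k; cases k <;> rfl
  | _ => simp_all [prename]

theorem psubst_prename (P : Proc) (ρ : ℕ → ℕ) (θ : ℕ → Proc) :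
    (P.prename ρ).psubst θ = P.psubst fun k => θ (ρ k) := by
  induction P generalizing ρ θ with
  | recu P ih =>
    simp only [prename_recu, psubst_recu, ih]
    congr 2
    funext k; cases k <;> rfl
  | _ => simp_all [prename, psubst]

theorem prename_psubst (P : Proc) (ρ : ℕ → ℕ) (θ : ℕ → Proc) :
    (P.psubst θ).prename ρ = P.psubst fun k => (θ k).prename ρ := by
  induction P generalizing ρ θ with
  | recu P ih =>
    simp only [prename_recu, psubst_recu, ih]
    congr 2
    funext k
    cases k with
    | zero => rfl
    | succ k => simp only [liftProc, prename_prename]; rfl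
  | _ => simp_all [prename, psubst, shift_prename, underPrefix_prename]

theorem psubst_pvar (P : Proc) : P.psubst pvar = P := by
  have hu : ∀ (α : Prefix) k, (pvar k).underPrefix α = pvar k := by
    intro α k; cases α <;> rfl
  induction P with
  | recu P ih =>
    have : liftProc pvar = pvar := by funext k; cases k <;> rfl
    rw [psubst_recu, this, ih]
  | sum w α P ih => simp only [psubst, hu]; congr 1; funext i; exact ih i
  | nu P ih => exact congrArg nu ih
  | prio x P Q ihP ihQ => exact congrArg₂ (prio x) ihP ihQ
  | _ => simp_all [psubst]

theorem subst_psubst (P : Proc) (σ : ℕ → Name) (θ : ℕ → Proc) :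
    (P.psubst θ).subst σ = (P.subst σ).psubst fun k => (θ k).subst σ := by
  induction P generalizing σ θ with
  | recu P ih =>
    simp only [psubst_recu, subst, ih]
    congr 2
    funext k
    cases k with
    | zero => rfl
    | succ k => simp only [liftProc, prename_subst]
  | _ => simp_all [psubst, subst, shift_subst_liftSubst, underPrefix_subst]

theorem shift_psubst (P : Proc) (θ : ℕ → Proc) :
    P.shift.psubst (fun k => (θ k).shift) = (P.psubst θ).shift :=
  (subst_psubst P _ θ).symm

theorem underPrefix_psubst (α : Prefix) (P : Proc) (θ : ℕ → Proc) :
    (P.underPrefix α).psubst (fun k => (θ k).underPrefix α) = (P.psubst θ).underPrefix α := by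
  cases α
  · exact shift_psubst P θ
  · rfl

theorem psubst_psubst (P : Proc) (θ θ' : ℕ → Proc) :
    (P.psubst θ).psubst θ' = P.psubst fun k => (θ k).psubst θ' := by
  induction P generalizing θ θ' with
  | recu P ih =>
    simp only [psubst_recu, ih]
    congr 2
    funext k
    cases k with
    | zero => rfl
    | succ k => simp only [liftProc, psubst_prename, prename_psubst]
  | _ => simp_all [psubst, shift_psubst, underPrefix_psubst]

theorem unfold_subst (P : Proc) (σ : ℕ → Name) : P.unfold.subst σ = (P.subst σ).unfold := by
  rw [unfold_eq, unfold_eq, subst_psubst]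
  congr 1
  funext k; cases k <;> rfl

theorem unfold_prename (P : Proc) (ρ : ℕ → ℕ) :
    P.unfold.prename ρ = (P.prename (liftRename ρ)).unfold := by
  rw [unfold_eq, unfold_eq, prename_psubst, psubst_prename]
  congr 1
  funext k; cases k <;> rfl

/-- Unfolding commutes with substitution, since weakening `θ k` under the binder and then
instantiating the binder gives `θ k` back. This is the recursion case of the closure of congruence
under substitution. -/
theorem unfold_psubst (P : Proc) (θ : ℕ → Proc) :
    P.unfold.psubst θ = (P.psubst (liftProc θ)).unfold := by
  rw [unfold_eq, unfold_eq, psubst_psubst, psubst_psubst]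
  congr 1
  funext k
  cases k with
  | zero => rfl
  | succ k =>
    change θ k = ((θ k).prename Nat.succ).psubst _
    rw [psubst_prename]
    exact (psubst_pvar (θ k)).symm

/-! ## Structural congruence without the guardedness condition -/

/-- Structural congruence, recursion being a congruence for arbitrary bodies. -/
inductive WCong : Proc → Proc → Prop
  | refl (P) : WCong P P
  | symm {P Q} : WCong P Q → WCong Q P
  | trans {P Q R} : WCong P Q → WCong Q R → WCong P R
  | par_comm (P Q) : WCong (par P Q) (par Q P)
  | recu_unfold (P) : WCong (recu P) P.unfold
  | ite_true (P Q) : WCong (ite (Name.bool true) P Q) P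
  | ite_false (P Q) : WCong (ite (Name.bool false) P Q) Q
  | sum {m : ℕ} (w : PMF (Fin m)) (α) {P Q : Fin m → Proc} :
      (∀ i, WCong (P i) (Q i)) → WCong (sum w α P) (sum w α Q)
  | nu {P Q} : WCong P Q → WCong (nu P) (nu Q)
  | par {P P' Q Q'} : WCong P P' → WCong Q Q' → WCong (par P Q) (par P' Q')
  | recu {P Q} : WCong P Q → WCong (recu P) (recu Q)
  | ite (b) {P P' Q Q'} : WCong P P' → WCong Q Q' → WCong (ite b P Q) (ite b P' Q')
  | prio (x) {P P' Q Q'} : WCong P P' → WCong Q Q' → WCong (prio x P Q) (prio x P' Q')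

/-- Without the side condition, closure under substitution needs no account of guardedness. A larger
relation is harmless, because only inversion results are wanted. -/
theorem Cong.wcong {P Q : Proc} (h : Cong P Q) : WCong P Q := by
  induction h with
  | refl P => exact .refl P
  | symm _ ih => exact .symm ih
  | trans _ _ h1 h2 => exact .trans h1 h2
  | par_comm P Q => exact .par_comm P Q
  | recu_unfold P => exact .recu_unfold P
  | ite_true P Q => exact .ite_true P Q
  | ite_false P Q => exact .ite_false P Q
  | sum w α _ ih => exact .sum w α ih
  | nu _ ih => exact .nu ih
  | par _ _ h1 h2 => exact .par h1 h2
  | recu _ _ _ ih => exact .recu ih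
  | ite b _ _ h1 h2 => exact .ite b h1 h2
  | prio x _ _ h1 h2 => exact .prio x h1 h2

namespace WCong

theorem subst {P Q : Proc} (h : WCong P Q) (σ : ℕ → Name) : WCong (P.subst σ) (Q.subst σ) := by
  induction h generalizing σ with
  | refl P => exact .refl _
  | symm _ ih => exact .symm (ih σ)
  | trans _ _ h1 h2 => exact .trans (h1 σ) (h2 σ)
  | par_comm P Q => exact .par_comm _ _
  | recu_unfold P => rw [unfold_subst]; exact .recu_unfold _
  | ite_true P Q => exact .ite_true _ _
  | ite_false P Q => exact .ite_false _ _
  | sum w α _ ih => exact .sum w _ fun i => ih i _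
  | nu _ ih => exact .nu (ih _)
  | par _ _ h1 h2 => exact .par (h1 σ) (h2 σ)
  | recu _ ih => exact .recu (ih _)
  | ite b _ _ h1 h2 => exact .ite _ (h1 σ) (h2 σ)
  | prio x _ _ h1 h2 => exact .prio _ (h1 _) (h2 σ)

theorem underPrefix {P Q : Proc} (h : WCong P Q) (α : Prefix) :
    WCong (P.underPrefix α) (Q.underPrefix α) := by
  cases α
  · exact h.subst _
  · exact h

theorem prename {P Q : Proc} (h : WCong P Q) (ρ : ℕ → ℕ) :
    WCong (P.prename ρ) (Q.prename ρ) := by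
  induction h generalizing ρ with
  | refl P => exact .refl _
  | symm _ ih => exact .symm (ih ρ)
  | trans _ _ h1 h2 => exact .trans (h1 ρ) (h2 ρ)
  | par_comm P Q => exact .par_comm _ _
  | recu_unfold P => rw [unfold_prename]; exact .recu_unfold _
  | ite_true P Q => exact .ite_true _ _
  | ite_false P Q => exact .ite_false _ _
  | sum w α _ ih => exact .sum w _ fun i => ih i _
  | nu _ ih => exact .nu (ih _)
  | par _ _ h1 h2 => exact .par (h1 ρ) (h2 ρ)
  | recu _ ih => exact .recu (ih _)
  | ite b _ _ h1 h2 => exact .ite _ (h1 ρ) (h2 ρ)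
  | prio x _ _ h1 h2 => exact .prio _ (h1 _) (h2 ρ)

theorem psubst {P Q : Proc} (h : WCong P Q) (θ : ℕ → Proc) :
    WCong (P.psubst θ) (Q.psubst θ) := by
  induction h generalizing θ with
  | refl P => exact .refl _
  | symm _ ih => exact .symm (ih θ)
  | trans _ _ h1 h2 => exact .trans (h1 θ) (h2 θ)
  | par_comm P Q => exact .par_comm _ _
  | recu_unfold P => rw [unfold_psubst]; exact .recu_unfold _
  | ite_true P Q => exact .ite_true _ _
  | ite_false P Q => exact .ite_false _ _
  | sum w α _ ih => exact .sum w _ fun i => ih i _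
  | nu _ ih => exact .nu (ih _)
  | par _ _ h1 h2 => exact .par (h1 θ) (h2 θ)
  | recu _ ih => exact .recu (ih _)
  | ite b _ _ h1 h2 => exact .ite _ (h1 θ) (h2 θ)
  | prio x _ _ h1 h2 => exact .prio _ (h1 _) (h2 θ)

theorem psubst_left (P : Proc) {θ θ' : ℕ → Proc} (h : ∀ k, WCong (θ k) (θ' k)) :
    WCong (P.psubst θ) (P.psubst θ') := by
  induction P generalizing θ θ' with
  | nil => exact .refl _
  | out x y => exact .refl _
  | sum w α P ih => exact .sum w _ fun i => ih i fun k => (h k).underPrefix _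
  | nu P ih => exact .nu (ih fun k => (h k).subst _)
  | par P Q h1 h2 => exact .par (h1 h) (h2 h)
  | pvar k => exact h k
  | recu P ih =>
    refine .recu (ih fun k => ?_)
    cases k with
    | zero => exact .refl _
    | succ k => exact (h k).prename _
  | ite b P Q h1 h2 => exact .ite _ (h1 h) (h2 h)
  | prio x P Q h1 h2 => exact .prio _ (h1 fun k => (h k).subst _) (h2 h)

theorem psubst_congr {P Q : Proc} (h : WCong P Q) {θ θ' : ℕ → Proc}
    (hθ : ∀ k, WCong (θ k) (θ' k)) : WCong (P.psubst θ) (Q.psubst θ') :=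
  (h.psubst θ).trans (psubst_left Q hθ)

end WCong

/-! ## Head evaluation -/

/-- `Ev n P h`: after `n` unfoldings of recursions and conditionals at its head, `P` becomes `h`,
which starts with an output, a sum, a restriction, a parallel composition or a priority choice. -/
inductive Ev : ℕ → Proc → Proc → Prop
  | out (x y) : Ev 0 (out x y) (out x y)
  | sum {m : ℕ} (w : PMF (Fin m)) (α P) : Ev 0 (sum w α P) (sum w α P)
  | nu (P) : Ev 0 (nu P) (nu P)
  | par (P Q) : Ev 0 (par P Q) (par P Q)
  | prio (x P Q) : Ev 0 (prio x P Q) (prio x P Q)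
  | recu {n P h} : Ev n P.unfold h → Ev (n + 1) (recu P) h
  | ite_true {n P Q h} : Ev n P h → Ev (n + 1) (ite (Name.bool true) P Q) h
  | ite_false {n P Q h} : Ev n Q h → Ev (n + 1) (ite (Name.bool false) P Q) h

/-- Evaluation is deterministic, and so is its length; the length serves to exclude circular
unfoldings. -/
theorem Ev.unique {n n' : ℕ} {P h h' : Proc} (H : Ev n P h) (H' : Ev n' P h') :
    n = n' ∧ h = h' := by
  induction H generalizing n' h' with
  | recu _ ih => cases H' with | recu H' => exact ⟨congrArg _ (ih H').1, (ih H').2⟩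
  | ite_true _ ih => cases H' with | ite_true H' => exact ⟨congrArg _ (ih H').1, (ih H').2⟩
  | ite_false _ ih => cases H' with | ite_false H' => exact ⟨congrArg _ (ih H').1, (ih H').2⟩
  | _ => cases H'; exact ⟨rfl, rfl⟩

theorem Ev.self {n : ℕ} {P h : Proc} (H : Ev n P h) : Ev 0 h h := by
  induction H with
  | recu _ ih => exact ih
  | ite_true _ ih => exact ih
  | ite_false _ ih => exact ih
  | _ => constructor

theorem Ev.psubst {n : ℕ} {P h : Proc} (H : Ev n P h) (θ : ℕ → Proc) :
    Ev n (P.psubst θ) (h.psubst θ) := by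
  induction H with
  | recu _ ih => rw [unfold_psubst] at ih; exact .recu ih
  | ite_true _ ih => exact .ite_true ih
  | ite_false _ ih => exact .ite_false ih
  | _ => constructor

/-- Evaluation either stops inside `P` or reaches a substituted process after some of the steps. The
induction is on the length, as an unfolding is not a smaller process. -/
theorem Ev.of_psubst {n : ℕ} {P h : Proc} {θ : ℕ → Proc} (H : Ev n (P.psubst θ) h) :
    (∃ h', Ev n P h' ∧ h = h'.psubst θ) ∨ ∃ k m, m ≤ n ∧ Ev m (θ k) h := by
  induction n using Nat.strong_induction_on generalizing P with
  | _ n ih =>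
  cases P with
  | nil => cases H
  | out x y => cases H; exact .inl ⟨_, .out _ _, rfl⟩
  | sum w α P => cases H; exact .inl ⟨_, .sum _ _ _, rfl⟩
  | nu P => cases H; exact .inl ⟨_, .nu _, rfl⟩
  | par P Q => cases H; exact .inl ⟨_, .par _ _, rfl⟩
  | prio x P Q => cases H; exact .inl ⟨_, .prio _ _ _, rfl⟩
  | pvar k => exact .inr ⟨k, n, le_rfl, H⟩
  | recu P =>
    rw [psubst_recu] at H
    cases H with
    | @recu n _ _ H =>
      rw [← unfold_psubst] at H
      rcases ih n (by omega) H with ⟨h', h1, h2⟩ | ⟨k, m, h1, h2⟩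
      · exact .inl ⟨h', .recu h1, h2⟩
      · exact .inr ⟨k, m, by omega, h2⟩
  | ite b P Q =>
    change Ev n (ite b (P.psubst θ) (Q.psubst θ)) h at H
    cases H with
    | @ite_true n _ _ _ H =>
      rcases ih n (by omega) H with ⟨h', h1, h2⟩ | ⟨k, m, h1, h2⟩
      · exact .inl ⟨h', .ite_true h1, h2⟩
      · exact .inr ⟨k, m, by omega, h2⟩
    | @ite_false n _ _ _ H =>
      rcases ih n (by omega) H with ⟨h', h1, h2⟩ | ⟨k, m, h1, h2⟩
      · exact .inl ⟨h', .ite_false h1, h2⟩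
      · exact .inr ⟨k, m, by omega, h2⟩

/-- The same head, and congruent components. -/
inductive Match : Proc → Proc → Prop
  | out (x y) : Match (out x y) (out x y)
  | sum {m : ℕ} (w : PMF (Fin m)) (α) {P Q : Fin m → Proc} :
      (∀ i, WCong (P i) (Q i)) → Match (sum w α P) (sum w α Q)
  | nu {P Q} : WCong P Q → Match (nu P) (nu Q)
  | par {P P' Q Q'} : WCong P P' → WCong Q Q' → Match (par P Q) (par P' Q')
  | par_swap {P P' Q Q'} : WCong P P' → WCong Q Q' → Match (par P Q) (par Q' P')
  | prio (x) {P P' Q Q'} : WCong P P' → WCong Q Q' → Match (prio x P Q) (prio x P' Q')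

namespace Match

theorem refl {n : ℕ} {P h : Proc} (H : Ev n P h) : Match h h := by
  have := H.self
  cases this with
  | out x y => exact .out x y
  | sum w α P => exact .sum w α fun i => .refl _
  | nu P => exact .nu (.refl _)
  | par P Q => exact .par (.refl _) (.refl _)
  | prio x P Q => exact .prio x (.refl _) (.refl _)

theorem trans {P Q R : Proc} (h : Match P Q) (h' : Match Q R) : Match P R := by
  cases h with
  | out x y => exact h'
  | sum w α h =>
    cases h' with | sum _ _ h' => exact .sum w α fun i => (h i).trans (h' i)
  | nu h => cases h' with | nu h' => exact .nu (h.trans h')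
  | par h1 h2 =>
    cases h' with
    | par h3 h4 => exact .par (h1.trans h3) (h2.trans h4)
    | par_swap h3 h4 => exact .par_swap (h1.trans h3) (h2.trans h4)
  | par_swap h1 h2 =>
    cases h' with
    | par h3 h4 => exact .par_swap (h1.trans h4) (h2.trans h3)
    | par_swap h3 h4 => exact .par (h1.trans h4) (h2.trans h3)
  | prio x h1 h2 => cases h' with | prio _ h3 h4 => exact .prio x (h1.trans h3) (h2.trans h4)

theorem psubst {P Q : Proc} (h : Match P Q) {θ θ' : ℕ → Proc}
    (hθ : ∀ k, WCong (θ k) (θ' k)) : Match (P.psubst θ) (Q.psubst θ') := by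
  cases h with
  | out x y => exact .out x y
  | sum w α h => exact .sum w α fun i => (h i).psubst_congr fun k => (hθ k).underPrefix _
  | nu h => exact .nu (h.psubst_congr fun k => (hθ k).subst _)
  | par h1 h2 => exact .par (h1.psubst_congr hθ) (h2.psubst_congr hθ)
  | par_swap h1 h2 => exact .par_swap (h1.psubst_congr hθ) (h2.psubst_congr hθ)
  | prio x h1 h2 =>
    exact .prio x (h1.psubst_congr fun k => (hθ k).subst _) (h2.psubst_congr hθ)

end Match

/-- `Q` has, up to congruence of the components, every head that `P` evaluates to. -/
def EvLE (P Q : Proc) : Prop := ∀ n h, Ev n P h → ∃ n' h', Ev n' Q h' ∧ Match h h'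

theorem EvLE.recu {P Q : Proc} (hPQ : WCong P Q) (H : EvLE P Q) : EvLE (recu P) (recu Q) := by
  intro n h hev
  have hθ : ∀ k, WCong (instProc (Proc.recu P) k) (instProc (Proc.recu Q) k) := by
    intro k
    cases k with
    | zero => exact .recu hPQ
    | succ k => exact .refl _
  cases hev with
  | @recu n _ _ hev =>
    rcases Ev.of_psubst hev with ⟨h', h1, rfl⟩ | ⟨k, m, h1, h2⟩
    · obtain ⟨n', h'', h3, h4⟩ := H _ _ h1
      exact ⟨n' + 1, _, .recu (h3.psubst _), h4.psubst hθ⟩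
    · cases k with
      -- Here the body evaluates to its own recursion variable, so `recu P` would reach `h` both in
      -- `m ≤ n` steps and in `n + 1` steps. No guardedness is needed.
      | zero => have := (h2.unique (.recu hev)).1; omega
      | succ k => cases h2

/-- The inversion principle for congruence. Both directions are carried through one induction
because of the symmetry rule; the recursion case is `EvLE.recu`. -/
theorem WCong.evLE {P Q : Proc} (h : WCong P Q) : EvLE P Q ∧ EvLE Q P := by
  induction h with
  | refl P => exact ⟨fun n h H => ⟨n, h, H, .refl H⟩, fun n h H => ⟨n, h, H, .refl H⟩⟩
  | symm _ ih => exact ih.symm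
  | trans _ _ h1 h2 =>
    constructor
    · intro n h H
      obtain ⟨_, _, H1, M1⟩ := h1.1 _ _ H
      obtain ⟨_, _, H2, M2⟩ := h2.1 _ _ H1
      exact ⟨_, _, H2, M1.trans M2⟩
    · intro n h H
      obtain ⟨_, _, H1, M1⟩ := h2.2 _ _ H
      obtain ⟨_, _, H2, M2⟩ := h1.2 _ _ H1
      exact ⟨_, _, H2, M1.trans M2⟩
  | par_comm P Q =>
    constructor <;> intro n h H <;> cases H <;>
      exact ⟨_, _, .par _ _, .par_swap (.refl _) (.refl _)⟩
  | recu_unfold P =>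
    constructor
    · intro n h H
      cases H with | recu H => exact ⟨_, _, H, .refl H⟩
    · intro n h H
      exact ⟨_, _, .recu H, .refl H⟩
  | ite_true P Q =>
    constructor
    · intro n h H
      cases H with | ite_true H => exact ⟨_, _, H, .refl H⟩
    · intro n h H
      exact ⟨_, _, .ite_true H, .refl H⟩
  | ite_false P Q =>
    constructor
    · intro n h H
      cases H with | ite_false H => exact ⟨_, _, H, .refl H⟩
    · intro n h H
      exact ⟨_, _, .ite_false H, .refl H⟩
  | sum w α h _ =>
    constructor <;> intro n h' H <;> cases H
    · exact ⟨_, _, .sum _ _ _, .sum w α h⟩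
    · exact ⟨_, _, .sum _ _ _, .sum w α fun i => (h i).symm⟩
  | nu h _ =>
    constructor <;> intro n h' H <;> cases H
    · exact ⟨_, _, .nu _, .nu h⟩
    · exact ⟨_, _, .nu _, .nu h.symm⟩
  | par h1 h2 _ _ =>
    constructor <;> intro n h' H <;> cases H
    · exact ⟨_, _, .par _ _, .par h1 h2⟩
    · exact ⟨_, _, .par _ _, .par h1.symm h2.symm⟩
  | recu h ih => exact ⟨.recu h ih.1, .recu h.symm ih.2⟩
  | ite b _ _ h1 h2 =>
    constructor <;> intro n h' H <;> cases H with
    | ite_true H =>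
      first
        | (obtain ⟨_, _, H1, M1⟩ := h1.1 _ _ H; exact ⟨_, _, .ite_true H1, M1⟩)
        | (obtain ⟨_, _, H1, M1⟩ := h1.2 _ _ H; exact ⟨_, _, .ite_true H1, M1⟩)
    | ite_false H =>
      first
        | (obtain ⟨_, _, H1, M1⟩ := h2.1 _ _ H; exact ⟨_, _, .ite_false H1, M1⟩)
        | (obtain ⟨_, _, H1, M1⟩ := h2.2 _ _ H; exact ⟨_, _, .ite_false H1, M1⟩)
  | prio x h1 h2 _ _ =>
    constructor <;> intro n h' H <;> cases H
    · exact ⟨_, _, .prio _ _ _, .prio x h1 h2⟩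
    · exact ⟨_, _, .prio _ _ _, .prio x h1.symm h2.symm⟩

/-- Inversion of congruence: the right-hand side evaluates to a given head. -/
theorem WCong.match_of_ev {P Q h : Proc} {n : ℕ} (hPQ : WCong P Q) (hP : Ev 0 P P)
    (hQ : Ev n Q h) : Match P h := by
  obtain ⟨_, _, H, M⟩ := hPQ.evLE.1 _ _ hP
  rw [(hQ.unique H).2]; exact M

theorem Ev.offers {n : ℕ} {P h : Proc} (H : Ev n P h) {x : Name} (hx : h.Offers x) :
    P.Offers x := by
  induction H with
  | recu _ ih => exact .recu (ih hx)
  | ite_true _ ih => exact .ite_true (ih hx)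
  | ite_false _ ih => exact .ite_false (ih hx)
  | _ => exact hx

end Proc

/-! ## The components of the network -/

namespace Election

open Proc

/-- The components that matter for the election: a pending output of a boolean on a channel, a
process that is about to draw, one that waits for the channel that it has drawn, and one that holds
this channel and tries to get the other one. -/
inductive Item : Type
  | tok (j : Fin 2) (b : Bool)
  | idle (i : Fin 2)
  | wait (i j : Fin 2)
  | hold (i j : Fin 2)
  deriving DecidableEq

/-- The recursive part of process `i`. -/
noncomputable def loop (i : Fin 2) : Proc :=
  recu (sum (PMF.uniformOfFintype (Fin 2))
    (fun k => Prefix.tau (some (i, i + k))) (fun k => branch i (i + k)))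

/-- Process `i`, holding channel `j`. -/
noncomputable def holder (i j : Fin 2) : Proc :=
  prio (x (j + 1)) (par (out (o i) (Name.num i)) (out (x j).shift (Name.bool false)))
    (par (out (x j) (Name.bool true)) (loop i))

namespace Item

/-- The process that a component stands for. -/
noncomputable def proc : Item → Proc
  | tok j b => out (x j) (Name.bool b)
  | idle i => loop i
  | wait i j => (branch i j).psubst (instProc (loop i))
  | hold i j => holder i j

/-- What becomes of a component when it receives the boolean `b` on channel `j`. -/
def recv : Item → Fin 2 → Bool → Option (Multiset Item)
  | wait i j, k, b => if k = j then some (if b then {hold i j} else 0) else none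
  | hold _ j, k, _ => if k = j + 1 then some {tok j false} else none
  | _, _, _ => none

end Item

open Item

theorem x_injective : Function.Injective x := by
  intro a b h
  fin_cases a <;> fin_cases b <;> first | rfl | cases h

theorem x_ne_chan (j : Fin 2) (k : ℕ) : x j ≠ Name.chan k := by
  fin_cases j <;> intro h <;> cases h

/-- The process is congruent to a parallel composition of the given components, besides inactive
processes and announcements of a leader. -/
inductive Comp : Proc → Multiset Item → Prop
  | nil {P} : WCong P nil → Comp P 0
  | msg {P} (k l : ℕ) : WCong P (out (Name.chan k) (Name.num l)) → Comp P 0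
  | item {P} (a : Item) : WCong P a.proc → Comp P {a}
  | par {P A B m₁ m₂} : WCong P (par A B) → Comp A m₁ → Comp B m₂ → Comp P (m₁ + m₂)

theorem Comp.congr {P Q : Proc} {m : Multiset Item} (h : Comp P m) (hQ : WCong Q P) :
    Comp Q m := by
  cases h with
  | nil h => exact .nil (hQ.trans h)
  | msg k l h => exact .msg k l (hQ.trans h)
  | item a h => exact .item a (hQ.trans h)
  | par h h1 h2 => exact .par (hQ.trans h) h1 h2

/-- The head of a component. -/
noncomputable def head : Item → Proc
  | idle i => sum (PMF.uniformOfFintype (Fin 2)) (fun k => Prefix.tau (some (i, i + k)))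
      fun k => (wait i (i + k)).proc
  | a => a.proc

theorem ev_head (a : Item) : ∃ n, Ev n a.proc (head a) := by
  cases a with
  | tok j b => exact ⟨0, .out _ _⟩
  | idle i => exact ⟨1, .recu (.sum _ _ _)⟩
  | wait i j => exact ⟨0, .sum _ _ _⟩
  | hold i j => exact ⟨0, .prio _ _ _⟩

theorem wait_proc (i j : Fin 2) :
    (wait i j).proc = sum (PMF.pure (0 : Fin 1)) (fun _ => Prefix.inp (x j)) fun _ => Proc.ite (Name.var 0)
      (prio (x (j + 1)).shift
        (par (out (o i) (Name.num i)) (out (x j).shift.shift (Name.bool false)))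
        (par (out (x j).shift (Name.bool true)) (loop i).shift))
      (out (o i) (Name.num ((i + 1 : Fin 2) : ℕ))) := rfl

/-- The form of a process that is its own head is forced by congruence inversion. In particular it
is never inaction, which has no head, nor a restriction. -/
theorem Comp.head_cases {P : Proc} {m : Multiset Item} (h : Comp P m) (hP : Ev 0 P P) :
    (∃ k l, P = out (Name.chan k) (Name.num l) ∧ m = 0) ∨ (∃ a, Match P (head a) ∧ m = {a}) ∨
      ∃ A B m₁ m₂, P = Proc.par A B ∧ m = m₁ + m₂ ∧ Comp A m₁ ∧ Comp B m₂ := by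
  cases h with
  | nil h =>
    obtain ⟨_, _, H, _⟩ := h.evLE.1 _ _ hP
    cases H
  | msg k l h =>
    have := h.match_of_ev hP (.out _ _)
    cases this
    exact .inl ⟨k, l, rfl, rfl⟩
  | item a h =>
    obtain ⟨n, H⟩ := ev_head a
    exact .inr (.inl ⟨a, h.match_of_ev hP H, rfl⟩)
  | par h h1 h2 =>
    have := h.match_of_ev hP (.par _ _)
    cases this with
    | par h3 h4 => exact .inr (.inr ⟨_, _, _, _, rfl, rfl, h1.congr h3, h2.congr h4⟩)
    | par_swap h3 h4 =>
      exact .inr (.inr ⟨_, _, _, _, rfl, add_comm _ _, h2.congr h3, h1.congr h4⟩)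

theorem Comp.par_inv {P Q : Proc} {m : Multiset Item} (h : Comp (Proc.par P Q) m) :
    ∃ m₁ m₂, m = m₁ + m₂ ∧ Comp P m₁ ∧ Comp Q m₂ := by
  rcases h.head_cases (.par _ _) with ⟨_, _, h, _⟩ | ⟨a, h, _⟩ | ⟨_, _, m₁, m₂, h, h'⟩
  · cases h
  · cases a <;> cases h
  · cases h; exact ⟨m₁, m₂, h'⟩

/-- A token that is present is seen by the priority choice: this is what blocks a release. -/
theorem Comp.offers {P : Proc} {m : Multiset Item} (h : Comp P m) {j : Fin 2} {b : Bool}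
    (hm : tok j b ∈ m) {Q : Proc} (hQ : WCong Q P) : Q.Offers (x j) := by
  induction h generalizing Q with
  | nil h => simp at hm
  | msg k l h => simp at hm
  | item a h =>
    rw [Multiset.mem_singleton] at hm
    subst hm
    obtain ⟨n, h', H, M⟩ := (hQ.trans h).evLE.2 _ _ (Ev.out _ _)
    cases M
    exact H.offers (.out _ _)
  | par h _ _ ih1 ih2 =>
    obtain ⟨n, h', H, M⟩ := (hQ.trans h).evLE.2 _ _ (Ev.par _ _)
    refine H.offers ?_
    rcases Multiset.mem_add.1 hm with hm | hm
    · cases M with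
      | par h3 h4 => exact .par_left (ih1 hm h3.symm)
      | par_swap h3 h4 => exact .par_right (ih1 hm h3.symm)
    · cases M with
      | par h3 h4 => exact .par_right (ih2 hm h4.symm)
      | par_swap h3 h4 => exact .par_left (ih2 hm h4.symm)

/-! ## The transitions of the components -/

/-- Silent steps other than draws, when the rest of the system offers outputs on `E`. -/
inductive Silent (E : Set Name) : Multiset Item → Multiset Item → Prop
  | release (i j : Fin 2) {m} : x (j + 1) ∉ E → (∀ b, tok (j + 1) b ∉ m) →
      Silent E (hold i j ::ₘ m) (tok j true ::ₘ idle i ::ₘ m)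
  | comm {a : Item} {j : Fin 2} {b : Bool} {r m} : a.recv j b = some r →
      Silent E (tok j b ::ₘ a ::ₘ m) (r + m)

/-- Groups that do not use a channel. The relation `R` tells what components a process has. -/
inductive Group (R : Proc → Multiset Item → Prop) (E : Set Name) (m : Multiset Item) :
    PMF (Act × Proc) → Prop
  | msg {k l : ℕ} {P'} : R P' m → Group R E m (PMF.pure (Act.out (Name.chan k) (Name.num l), P'))
  | silent {m' P'} : Silent E m m' → R P' m' → Group R E m (PMF.pure (Act.tau none, P'))
  | draw {i : Fin 2} {m' : Multiset Item} {T : Fin 2 → Proc} : m = idle i ::ₘ m' →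
      (∀ k, R (T k) (wait i (i + k) ::ₘ m')) →
      Group R E m ((PMF.uniformOfFintype (Fin 2)).map
        fun k => (Act.tau (some (i, i + k)), T k))

/-- Groups of a process with components `m`. -/
inductive Trans (E : Set Name) (m : Multiset Item) : PMF (Act × Proc) → Prop
  | group {g} : Group Comp E m g → Trans E m g
  | out {j : Fin 2} {b : Bool} {m' P'} : m = tok j b ::ₘ m' → Comp P' m' →
      Trans E m (PMF.pure (Act.out (x j) (Name.bool b), P'))
  | inp {j : Fin 2} {a : Item} {m' P'} {r : Bool → Multiset Item} : m = a ::ₘ m' →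
      (∀ b, a.recv j b = some (r b) ∧ Comp (P'.subst (Name.inst (Name.bool b))) (r b + m')) →
      Trans E m (PMF.pure (Act.inp (x j), P'))

theorem Comp.add {A B : Proc} {m₁ m₂ : Multiset Item} (h₁ : Comp A m₁) (h₂ : Comp B m₂) :
    Comp (Proc.par A B) (m₁ + m₂) := .par (.refl _) h₁ h₂

theorem Comp.item_proc (a : Item) : Comp a.proc {a} := .item a (.refl _)

/-- The environment of a part contains the offers of its siblings, so a release allowed in the part
remains allowed in the whole. -/
theorem Silent.add {E E' : Set Name} {m m' n : Multiset Item} (h : Silent E m m')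
    (hE : ∀ j, x j ∈ E' ∨ (∃ b, tok j b ∈ n) → x j ∈ E) : Silent E' (m + n) (m' + n) := by
  cases h with
  | @release i j m h1 h2 =>
    rw [Multiset.cons_add, Multiset.cons_add, Multiset.cons_add]
    refine .release i j (fun h => h1 (hE _ (.inl h))) fun b hb => ?_
    rcases Multiset.mem_add.1 hb with hb | hb
    · exact h2 b hb
    · exact h1 (hE _ (.inr ⟨b, hb⟩))
  | @comm a j b r m h =>
    rw [Multiset.cons_add, Multiset.cons_add, add_assoc]
    exact .comm h

/-- `Q` has `n` more components than `P`, if `P` and `Q` are reached by the action `μ`. -/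
def Extends (n : Multiset Item) (P Q : Proc) : Act → Prop
  | Act.inp _ => ∀ b m, Comp (P.subst (Name.inst b)) m → Comp (Q.subst (Name.inst b)) (m + n)
  | _ => ∀ m, Comp P m → Comp Q (m + n)

theorem extends_of_wcong {P Q : Proc} (h : WCong Q P) (μ : Act) : Extends 0 P Q μ := by
  cases μ with
  | inp z => intro b m hm; rw [add_zero]; exact hm.congr (h.subst _)
  | _ => intro m hm; rw [add_zero]; exact hm.congr h

/-- After an input, components are counted only once a boolean is received; this substitution
cancels the shift of `Q`. After a bound output nothing would cancel it, hence the exclusion. -/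
theorem extends_par {P Q R : Proc} {n : Multiset Item} {μ : Act} (hQ : Comp Q n)
    (hμ : ∀ z, μ ≠ Act.bout z) (h : WCong R (Proc.par P (Q.under μ))) : Extends n P R μ := by
  cases μ with
  | inp z =>
    intro b m hm
    refine (hm.add hQ).congr ((h.subst _).trans ?_)
    change WCong (Proc.par _ (Q.shift.subst _)) _
    rw [Proc.shift_subst_inst]
    exact .refl _
  | bout z => exact (hμ z rfl).elim
  | _ => intro m hm; exact (hm.add hQ).congr h

/-- Covers at once the inheritance by a parallel composition, a communication rule in which nothing
synchronizes, and congruence (with `n = 0`). -/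
theorem Trans.map {E E' : Set Name} {m n : Multiset Item} {g : PMF (Act × Proc)}
    {f : Act × Proc → Act × Proc} (h : Trans E m g)
    (hE : ∀ j, x j ∈ E' ∨ (∃ b, tok j b ∈ n) → x j ∈ E)
    (hf : ∀ a ∈ g.support, (f a).1 = a.1 ∧ Extends n a.2 (f a).2 a.1) :
    Trans E' (m + n) (g.map f) := by
  cases h with
  | group h =>
    cases h with
    | msg h =>
      obtain ⟨h1, h2⟩ := hf _ ((PMF.mem_support_pure_iff _ _).2 rfl)
      rw [PMF.pure_map, ← Prod.mk.eta (p := f _), h1]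
      exact .group (.msg (h2 _ h))
    | silent hs h =>
      obtain ⟨h1, h2⟩ := hf _ ((PMF.mem_support_pure_iff _ _).2 rfl)
      rw [PMF.pure_map, ← Prod.mk.eta (p := f _), h1]
      exact .group (.silent (hs.add hE) (h2 _ h))
    | @draw i m' T hm h =>
      have hf' : ∀ k, (f (Act.tau (some (i, i + k)), T k)).1 = Act.tau (some (i, i + k)) ∧
          ∀ m, Comp (T k) m → Comp (f (Act.tau (some (i, i + k)), T k)).2 (m + n) :=
        fun k => hf _ (by simp)
      have : (f ∘ fun k => (Act.tau (some (i, i + k)), T k)) = fun k =>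
          (Act.tau (some (i, i + k)), (f (Act.tau (some (i, i + k)), T k)).2) :=
        funext fun k => Prod.ext (hf' k).1 rfl
      rw [PMF.map_comp, this]
      refine .group (.draw (m' := m' + n) (by rw [hm, Multiset.cons_add]) fun k => ?_)
      rw [← Multiset.cons_add]
      exact (hf' k).2 _ (h k)
  | out hm h =>
    obtain ⟨h1, h2⟩ := hf _ ((PMF.mem_support_pure_iff _ _).2 rfl)
    rw [PMF.pure_map, ← Prod.mk.eta (p := f _), h1]
    exact .out (by rw [hm, Multiset.cons_add]) (h2 _ h)
  | inp hm h =>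
    obtain ⟨h1, h2⟩ := hf _ ((PMF.mem_support_pure_iff _ _).2 rfl)
    rw [PMF.pure_map, ← Prod.mk.eta (p := f _), h1]
    refine .inp (by rw [hm, Multiset.cons_add]) fun b => ⟨(h b).1, ?_⟩
    rw [← add_assoc]
    exact h2 _ _ (h b).2

theorem Trans.ne_bout {E : Set Name} {m : Multiset Item} {g : PMF (Act × Proc)}
    (h : Trans E m g) {a : Act × Proc} (ha : a ∈ g.support) (z : Name) : a.1 ≠ Act.bout z := by
  rcases a with ⟨μ, P⟩
  rintro rfl
  cases h with
  | group h => cases h <;> simp at ha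
  | out => simp at ha
  | inp => simp at ha

theorem Trans.of_out {E : Set Name} {m : Multiset Item} {y v : Name} {P' : Proc}
    (h : Trans E m (PMF.pure (Act.out y v, P'))) :
    (∃ j b m', y = x j ∧ v = Name.bool b ∧ m = tok j b ::ₘ m' ∧ Comp P' m') ∨
      ∃ k l, y = Name.chan k ∧ v = Name.num l ∧ Comp P' m := by
  generalize hg : PMF.pure (Act.out y v, P') = g at h
  have hs : (Act.out y v, P') ∈ g.support := by rw [← hg]; simp
  cases h with
  | group h =>
    cases h with
    | msg h => simp at hs; obtain ⟨⟨rfl, rfl⟩, rfl⟩ := hs; exact .inr ⟨_, _, rfl, rfl, h⟩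
    | silent => simp at hs
    | draw => simp at hs
  | out hm h => simp at hs; obtain ⟨⟨rfl, rfl⟩, rfl⟩ := hs; exact .inl ⟨_, _, _, rfl, rfl, hm, h⟩
  | inp => simp at hs

theorem Trans.of_wait {i j : Fin 2} {E : Set Name} {P' : Proc}
    (h : ∀ b, WCong (P'.subst (Name.inst (Name.bool b))) (Proc.ite (Name.bool b) (holder i j)
      (Proc.out (o i) (Name.num ((i + 1 : Fin 2) : ℕ))))) :
    Trans E {wait i j} (PMF.pure (Act.inp (x j), P')) := by
  refine .inp (a := wait i j) (m' := 0) (r := fun b => if b then {hold i j} else 0) rfl fun b => ?_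
  refine ⟨by simp [recv], ?_⟩
  cases b
  · exact .msg _ _ ((h false).trans (.ite_false _ _))
  · exact .item _ ((h true).trans (.ite_true _ _))

/-- Induction on the derivation: `head_cases` identifies the component behind an axiom, and
`Trans.map` transports groups. The restriction rules cannot apply, and no bound output ever arises.
-/
theorem Comp.trans {E : Set Name} {P : Proc} {g : PMF (Act × Proc)} (h : Step E P g) :
    ∀ m, Comp P m → Trans E m g := by
  induction h with
  | sum E w α P =>
    intro m hm
    rcases hm.head_cases (.sum _ _ _) with ⟨_, _, h, _⟩ | ⟨a, h, rfl⟩ | ⟨_, _, _, _, h, _⟩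
    · cases h
    · cases a with
      | tok => cases h
      | hold => cases h
      | idle i =>
        cases h with
        | sum _ _ h =>
          exact .group (.draw (m' := 0) rfl fun k => .item _ (h k))
      | wait i j =>
        rw [head, wait_proc] at h
        · cases h with
          | sum _ _ h =>
            rw [PMF.pure_map]
            refine .of_wait fun b => ((h 0).subst _).trans ?_
            simp only [Proc.subst, Name.shift_subst_inst, Proc.shift_subst_inst,
              Name.shift_subst_liftSubst]
            exact .refl _
        · intro i h; cases h
    · cases h
  | out E y v =>
    intro m hm
    rcases hm.head_cases (.out _ _) with ⟨_, _, h, rfl⟩ | ⟨a, h, rfl⟩ | ⟨_, _, _, _, h, _⟩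
    · cases h; exact .group (.msg (.nil (.refl _)))
    · cases a with
      | tok j b => cases h; exact .out (m' := 0) rfl (.nil (.refl _))
      | _ => cases h
    · cases h
  | prio_inp E y P Q =>
    intro m hm
    rcases hm.head_cases (.prio _ _ _) with ⟨_, _, h, _⟩ | ⟨a, h, rfl⟩ | ⟨_, _, _, _, h, _⟩
    · cases h
    · cases a with
      | hold i j =>
        cases h with
        | prio _ h1 h2 =>
          refine .inp (a := hold i j) (m' := 0) (r := fun _ => {tok j false}) rfl fun b =>
            ⟨by simp [recv], ?_⟩
          refine .congr ?_ (h1.subst _)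
          change Comp (Proc.par (Proc.out (o i) _) (Proc.out ((x j).shift.subst _) _)) _
          rw [Name.shift_subst_inst, add_comm]
          exact Comp.add (.msg _ _ (.refl _)) (Comp.item_proc (tok j false))
      | _ => cases h
    · cases h
  | @prio_tau E y P Q hy =>
    intro m hm
    rcases hm.head_cases (.prio _ _ _) with ⟨_, _, h, _⟩ | ⟨a, h, rfl⟩ | ⟨_, _, _, _, h, _⟩
    · cases h
    · cases a with
      | hold i j =>
        cases h with
        | prio _ h1 h2 =>
          refine .group (.silent (.release i j (m := 0) hy (by simp)) ?_)
          exact ((Comp.item_proc (tok j true)).add (Comp.item_proc (idle i))).congr h2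
      | _ => cases h
    · cases h
  | opn =>
    intro m hm
    rcases hm.head_cases (.nu _) with ⟨_, _, h, _⟩ | ⟨a, h, rfl⟩ | ⟨_, _, _, _, h, _⟩
    · cases h
    · cases a <;> cases h
    · cases h
  | res =>
    intro m hm
    rcases hm.head_cases (.nu _) with ⟨_, _, h, _⟩ | ⟨a, h, rfl⟩ | ⟨_, _, _, _, h, _⟩
    · cases h
    · cases a <;> cases h
    · cases h
  | @par E P Q g _ ih =>
    intro m hm
    obtain ⟨m₁, m₂, rfl, h1, h2⟩ := hm.par_inv
    have ht := ih m₁ h1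
    refine ht.map ?_ fun a ha => ⟨rfl, extends_par h2 (ht.ne_bout ha) (.refl _)⟩
    rintro j (h | ⟨b, h⟩)
    · exact .inl h
    · exact .inr (h2.offers h (.refl _))
  | @com E P P' Q g y v _ _ ih1 ih2 =>
    intro m hm
    obtain ⟨m₁, m₂, hmm, h1, h2⟩ := hm.par_inv
    have hE : ∀ j, x j ∈ E ∨ (∃ b, tok j b ∈ m₁) → x j ∈ E ∪ {x | P.Offers x} := by
      rintro j (h | ⟨b, h⟩)
      · exact .inl h
      · exact .inr (h1.offers h (.refl _))
    have ht := ih2 m₂ h2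
    -- Inputs occur only in one-point groups: either `g` is a single matching input, or no branch of
    -- `g` synchronizes and the rule merely adds `P` in parallel.
    by_cases hg : ∃ P'', g = PMF.pure (Act.inp y, P'')
    · obtain ⟨P'', rfl⟩ := hg
      rw [PMF.pure_map, hmm]
      generalize hg : PMF.pure (Act.inp y, P'') = g at ht
      have hs : (Act.inp y, P'') ∈ g.support := by rw [← hg]; simp
      cases ht with
      | group h => cases h <;> simp at hs
      | out => simp at hs
      | @inp j a m' P' r hm h =>
        simp at hs
        obtain ⟨rfl, rfl⟩ := hs
        rcases (ih1 m₁ h1).of_out with ⟨j', b, m'', hj, rfl, rfl, h'⟩ | ⟨k, l, hk, _⟩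
        · obtain rfl := x_injective hj
          simp only [comTarget, if_true]
          have hsil : Silent E (tok j b ::ₘ a ::ₘ (m'' + m')) (r b + (m'' + m')) :=
            .comm (h b).1
          have e1 : tok j b ::ₘ m'' + m₂ = tok j b ::ₘ a ::ₘ (m'' + m') := by
            rw [hm, Multiset.cons_add, Multiset.add_cons]
          have e2 : r b + (m'' + m') = m'' + (r b + m') := add_left_comm _ _ _
          rw [e1]
          rw [e2] at hsil
          exact .group (.silent hsil (h'.add (h b).2))
        · exact absurd hk (x_ne_chan _ _)
    · rw [hmm, add_comm]
      refine ht.map hE fun a ha => ?_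
      have hb := ht.ne_bout ha
      rcases a with ⟨_ | _ | _ | _, R⟩
      · rename_i z
        have hz : z ≠ y := by
          rintro rfl
          cases ht with
          | group h => cases h <;> simp at ha
          | out => simp at ha
          | inp => cases (PMF.mem_support_pure_iff _ _).1 ha; exact hg ⟨_, rfl⟩
        simp only [comTarget, if_neg hz, true_and]
        exact extends_par h1 hb (.par_comm _ _)
      all_goals exact ⟨rfl, extends_par h1 hb (.par_comm _ _)⟩
  | close _ _ ih1 ih2 =>
    intro m hm
    obtain ⟨m₁, m₂, rfl, h1, h2⟩ := hm.par_inv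
    exact ((ih1 m₁ h1).ne_bout ((PMF.mem_support_pure_iff _ _).2 rfl) _ rfl).elim
  | @cong E P P' g f hc _ hf ih =>
    intro m hm
    rw [← add_zero m]
    refine (ih m (hm.congr hc.wcong.symm)).map ?_ fun a ha =>
      ⟨rfl, extends_of_wcong (hf a ha).wcong.symm _⟩
    rintro j (h | ⟨b, h⟩)
    · exact h
    · simp at h

/-! ## Restriction -/
/-! ## Restriction -/

/-- The process is congruent to the restriction of a process in `R`. -/
def NuOf (R : Proc → Multiset Item → Prop) (P : Proc) (m : Multiset Item) : Prop :=
  ∃ Q, WCong P (nu Q) ∧ R Q m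

theorem NuOf.congr {R : Proc → Multiset Item → Prop} {P Q : Proc} {m : Multiset Item}
    (h : NuOf R P m) (hQ : WCong Q P) : NuOf R Q m := by
  obtain ⟨P', h1, h2⟩ := h
  exact ⟨P', hQ.trans h1, h2⟩

theorem _root_.Proc.WCong.nu_inv {P Q : Proc} (h : WCong (nu P) (nu Q)) : WCong P Q := by
  have := h.match_of_ev (.nu _) (.nu _)
  cases this with | nu h => exact h

/-- Every group of a restricted process comes from a group of the process under the restriction. -/
theorem NuOf.step {R : Proc → Multiset Item → Prop}
    (hR : ∀ {P Q m}, R P m → WCong Q P → R Q m) {m : Multiset Item} {E : Set Name} {P : Proc}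
    {g : PMF (Act × Proc)} (hs : Step E P g) (hE : E = ∅) (hP : NuOf R P m) :
    ∃ Q g', R Q m ∧ Step ∅ Q g' ∧
      ((∃ y P', g' = PMF.pure (Act.out y (Name.var 0), P')) ∨
        ∃ (h : ∃ a ∈ {a : Act × Proc | ¬ a.1.HasFree (Name.var 0)}, a ∈ g'.support)
          (f : Act × Proc → Proc), (∀ a ∈ (g'.filter _ h).support, WCong (f a) (resTarget a).2) ∧
            g = (g'.filter _ h).map fun a => ((resTarget a).1, f a)) := by
  induction hs with
  | @opn E P P' y _ h _ =>
    subst hE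
    obtain ⟨Q, h1, h2⟩ := hP
    rw [Set.image_empty] at h
    exact ⟨P, _, hR h2 h1.nu_inv, h, .inl ⟨_, _, rfl⟩⟩
  | @res E P g' h hs _ =>
    subst hE
    obtain ⟨Q, h1, h2⟩ := hP
    rw [Set.image_empty] at hs
    exact ⟨P, _, hR h2 h1.nu_inv, hs, .inr ⟨h, fun a => (resTarget a).2, fun a _ => .refl _, rfl⟩⟩
  | @cong E P P' g f hc _ hf ih =>
    obtain ⟨Q, g', h1, h2, h3⟩ := ih hE (hP.congr hc.wcong.symm)
    refine ⟨Q, g', h1, h2, h3.imp_right ?_⟩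
    rintro ⟨h, f', h4, rfl⟩
    refine ⟨h, fun a => f ((resTarget a).1, f' a), fun a ha => ?_, by rw [PMF.map_comp]; rfl⟩
    exact (hf _ ((PMF.mem_support_map_iff _ _ _).2 ⟨a, ha, rfl⟩)).wcong.symm.trans (h4 a ha)
  -- The other rules apply to processes with another head, which are not congruent to a restriction.
  | _ =>
    obtain ⟨Q, h1, h2⟩ := hP
    have := h1.match_of_ev (by constructor) (.nu _)
    cases this

theorem filter_eq_self {α : Type*} (p : PMF α) {s : Set α} (h : ∃ a ∈ s, a ∈ p.support)
    (hs : p.support ⊆ s) : p.filter s h = p := by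
  have : s.indicator p = p := by
    rw [Set.indicator_eq_self]; exact hs
  ext a
  rw [PMF.filter_apply, this, p.tsum_coe, inv_one, mul_one]

/-- None of these actions has the restricted name free, so nothing is dropped or renormalized, and
draws stay uniform. -/
theorem Group.res {R : Proc → Multiset Item → Prop} {E : Set Name} {m : Multiset Item}
    {g : PMF (Act × Proc)} (hg : Group R E m g)
    (h : ∃ a ∈ {a : Act × Proc | ¬ a.1.HasFree (Name.var 0)}, a ∈ g.support)
    {f : Act × Proc → Proc} (hf : ∀ a ∈ (g.filter _ h).support, WCong (f a) (resTarget a).2) :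
    Group (NuOf R) E m ((g.filter _ h).map fun a => ((resTarget a).1, f a)) := by
  have hs : g.support ⊆ {a : Act × Proc | ¬ a.1.HasFree (Name.var 0)} := by
    rintro ⟨μ, P⟩ ha
    cases hg with
    | msg => cases (PMF.mem_support_pure_iff _ _).1 ha; simp [Act.HasFree]
    | silent => cases (PMF.mem_support_pure_iff _ _).1 ha; simp [Act.HasFree]
    | draw =>
      obtain ⟨k, _, hk⟩ := (PMF.mem_support_map_iff _ _ _).1 ha
      cases hk; simp [Act.HasFree]
  rw [filter_eq_self g h hs] at hf ⊢
  cases hg with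
  | msg hP =>
    rw [PMF.pure_map]
    exact .msg ⟨_, hf _ ((PMF.mem_support_pure_iff _ _).2 rfl), hP⟩
  | silent hm hP =>
    rw [PMF.pure_map]
    exact .silent hm ⟨_, hf _ ((PMF.mem_support_pure_iff _ _).2 rfl), hP⟩
  | @draw i m' T hm hP =>
    rw [PMF.map_comp]
    exact .draw (T := fun k => f (Act.tau (some (i, i + k)), T k)) hm
      fun k => ⟨T k, hf (Act.tau (some (i, i + k)), T k) (by simp), hP k⟩

theorem Group.not_out_var {R : Proc → Multiset Item → Prop} {E : Set Name} {m : Multiset Item}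
    {y : Name} {k : ℕ} {P : Proc} (h : Group R E m (PMF.pure (Act.out y (Name.var k), P))) :
    False := by
  generalize hg : PMF.pure (Act.out y (Name.var k), P) = g at h
  have hs : (Act.out y (Name.var k), P) ∈ g.support := by rw [← hg]; simp
  cases h <;> simp at hs

/-- The action uses the channel `var 0`, without sending a restricted name. -/
def Visible : Act → Prop
  | Act.inp y => y = Name.var 0
  | Act.out y v => y = Name.var 0 ∧ ∃ b, v = Name.bool b
  | _ => False

theorem pure_of_filter {p : Act × Proc} {s : Set (Act × Proc)}
    (h : ∃ a ∈ s, a ∈ (PMF.pure p).support) : p ∈ s := by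
  obtain ⟨a, h1, h2⟩ := h
  cases (PMF.mem_support_pure_iff _ _).1 h2
  exact h1

theorem filter_pure {p : Act × Proc} {s : Set (Act × Proc)}
    (h : ∃ a ∈ s, a ∈ (PMF.pure p).support) : (PMF.pure p).filter s h = PMF.pure p :=
  filter_eq_self _ h fun a ha => by
    cases (PMF.mem_support_pure_iff _ _).1 ha; exact pure_of_filter h

theorem x_lower {j : Fin 2} (h : Name.var 0 ≠ x j) : (x j).lower = Name.var 0 := by
  fin_cases j
  · rfl
  · exact (h rfl).elim

/-- The inner restriction removes the groups on `x 1`; those on `x 0` survive with the channel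
lowered to `var 0`. Nothing is recorded about their targets, as the outer restriction removes them.
-/
theorem group_nu {m : Multiset Item} {P : Proc} {g : PMF (Act × Proc)} (hs : Step ∅ P g)
    (hP : NuOf Comp P m) :
    Group (NuOf Comp) ∅ m g ∨ ∃ μ P', Visible μ ∧ g = PMF.pure (μ, P') := by
  obtain ⟨Q, g', h1, h2, h3⟩ := NuOf.step (fun h hQ => h.congr hQ) hs rfl hP
  have ht := Comp.trans h2 m h1
  rcases h3 with ⟨y, P', rfl⟩ | ⟨h, f, hf, rfl⟩
  · rcases ht.of_out with ⟨_, _, _, _, h, _⟩ | ⟨_, _, _, h, _⟩ <;> cases h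
  · cases ht with
    | group hg => exact .inl (hg.res h hf)
    | @out j b m' P' hm hc =>
      have := pure_of_filter h
      refine .inr ⟨Act.out (x j).lower (Name.bool b), f (Act.out (x j) (Name.bool b), P'),
        ⟨x_lower fun h => this (.inl h), b, rfl⟩, ?_⟩
      rw [filter_pure, PMF.pure_map]; rfl
    | @inp j a m' P' r hm hc =>
      have := pure_of_filter h
      refine .inr ⟨Act.inp (x j).lower, f (Act.inp (x j), P'), x_lower fun h => this h, ?_⟩
      rw [filter_pure, PMF.pure_map]; rfl

/-- The process is congruent to the network with the given components. -/
def Net : Proc → Multiset Item → Prop := NuOf (NuOf Comp)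

theorem Net.group {m : Multiset Item} {P : Proc} {g : PMF (Act × Proc)} (hs : Step ∅ P g)
    (hP : Net P m) : Group Net ∅ m g := by
  obtain ⟨Q, g', h1, h2, h3⟩ := NuOf.step (fun h hQ => h.congr hQ) hs rfl hP
  have ht := group_nu h2 h1
  rcases h3 with ⟨y, P', rfl⟩ | ⟨h, f, hf, rfl⟩
  · rcases ht with ht | ⟨μ, P'', hμ, hg⟩
    · exact ht.not_out_var.elim
    · have : (Act.out y (Name.var 0), P') ∈ (PMF.pure (μ, P'')).support := by rw [← hg]; simp
      cases (PMF.mem_support_pure_iff _ _).1 this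
      obtain ⟨_, _, h⟩ := hμ
      cases h
  · rcases ht with ht | ⟨μ, P'', hμ, rfl⟩
    · exact ht.res h hf
    -- The only point of this group is dropped, so the rule, which requires a remaining transition,
    -- does not apply.
    · refine (pure_of_filter h ?_).elim
      cases μ with
      | inp y => exact hμ.symm
      | out y v => exact .inl hμ.1.symm
      | bout => exact hμ.elim
      | tau => exact hμ.elim

theorem net_network : Net network {tok 0 true, idle 0, tok 1 true, idle 1} := by
  refine ⟨_, .refl _, _, .refl _, ?_⟩
  exact ((Comp.item_proc (tok 0 true)).add (Comp.item_proc (idle 0))).add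
    ((Comp.item_proc (tok 1 true)).add (Comp.item_proc (idle 1)))

/-! ## Ranks -/

/-- The reachable components, with a rank: with rank 0 no draw can follow; with rank 1, at least
one of the two results of the next draw leads to rank 0; with rank 2, no draw has been made. -/
def ranked : List (ℕ × Multiset Item) :=
  (2, {tok 0 true, idle 0, tok 1 true, idle 1}) :: (0, 0) ::
  ([0, 1] : List (Fin 2)).flatMap fun j => (0, {tok j false}) ::
    ([0, 1] : List (Fin 2)).flatMap fun i => [
      (1, {tok 0 true, tok 1 true, idle i, wait (i + 1) j}),
      (1, {tok (j + 1) true, idle i, hold (i + 1) j}),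
      (1, {tok 0 true, tok 1 true, wait i j, wait (i + 1) (j + 1)}),
      (1, {tok (j + 1) true, hold i j, wait (i + 1) (j + 1)}),
      (1, {hold i j, hold (i + 1) (j + 1)}),
      (1, {tok j false, idle i}),
      (0, {tok 0 true, tok 1 true, wait i j, wait (i + 1) j}),
      (0, {tok (j + 1) true, hold i j, wait (i + 1) j}),
      (0, {tok j false, wait i 0}),
      (0, {tok j false, wait i 1})]

/-- The components `m` have a rank that is at most `r`. -/
def RankLE (r : ℕ) (m : Multiset Item) : Prop := ∃ s ∈ ranked, s.1 ≤ r ∧ s.2 = m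

instance (r : ℕ) (m : Multiset Item) : Decidable (RankLE r m) :=
  inferInstanceAs (Decidable (∃ s ∈ ranked, s.1 ≤ r ∧ s.2 = m))

set_option maxRecDepth 100000 in
theorem ranked_comm : ∀ s ∈ ranked, ∀ j b, tok j b ∈ s.2 → ∀ a ∈ s.2.erase (tok j b),
    ∀ r ∈ a.recv j b, RankLE s.1 (r + (s.2.erase (tok j b)).erase a) := by
  decide +kernel

set_option maxRecDepth 100000 in
-- Among the listed multisets, only those with both channels held allow a release.
theorem ranked_release : ∀ s ∈ ranked, ∀ i j, hold i j ∈ s.2 →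
    (∀ b, tok (j + 1) b ∉ s.2.erase (hold i j)) →
    RankLE s.1 (tok j true ::ₘ idle i ::ₘ s.2.erase (hold i j)) := by
  decide +kernel

set_option maxRecDepth 100000 in
-- In rank 1 the favourable result `k` selects the channel of the committed opponent; if the
-- opponent has already won, both results are favourable. No multiset of rank 0 contains an idle
-- process.
theorem ranked_draw : ∀ s ∈ ranked, ∀ i, idle i ∈ s.2 →
    (s.1 = 2 ∧ ∀ k, RankLE 1 (wait i (i + k) ::ₘ s.2.erase (idle i))) ∨
    (s.1 = 1 ∧ ∃ k, RankLE 0 (wait i (i + k) ::ₘ s.2.erase (idle i)) ∧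
      RankLE 1 (wait i (i + (k + 1)) ::ₘ s.2.erase (idle i))) := by
  decide +kernel

theorem Silent.rankLE {m m' : Multiset Item} (h : Silent ∅ m m') {r : ℕ} (hm : (r, m) ∈ ranked) :
    RankLE r m' := by
  cases h with
  | release i j _ h => simpa using ranked_release _ hm i j (by simp) (by simpa using h)
  | comm h => simpa using ranked_comm _ hm _ _ (by simp) _ (by simp) _ h

end Election

/-! ## Executions -/

namespace ProbAutomaton.Adversary

variable {S A : Type} {M : ProbAutomaton S A}

/-- The law of two successive nodes of an execution. -/
theorem lintegral_execMeasure_succ (ζ : M.Adversary) (t : ℕ) {F : Node S A × Node S A → ℝ≥0∞}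
    (hF : Measurable F) :
    ∫⁻ ω, F (ω t, ω (t + 1)) ∂ζ.execMeasure =
      ∫⁻ ω, ∫⁻ y, F (ω t, y) ∂(ζ.next (ω t)).toMeasure ∂ζ.execMeasure := by
  let G : (Finset.Iic t → Node S A) × Node S A → ℝ≥0∞ :=
    fun p => F (p.1 ⟨t, Finset.mem_Iic.2 le_rfl⟩, p.2)
  have hG : Measurable G := by fun_prop
  let r : (ℕ → Node S A) → (Finset.Iic t → Node S A) := Preorder.frestrictLe t
  have hr : Measurable r := Preorder.measurable_frestrictLe t
  -- The first `t + 1` nodes and the next one have as joint law the composition product of the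
  -- truncated trajectory with the step kernel.
  have h1 := Kernel.partialTraj_compProd_eq_map_traj (X := fun _ => Node S A)
    (κ := ζ.stepKernel) (Nat.zero_le t) (x₀ := fun _ => Node.root)
  have h2 : ζ.execMeasure.map r = Kernel.partialTraj (X := fun _ => Node S A) ζ.stepKernel 0 t
      (fun _ => Node.root) := Kernel.traj_map_frestrictLe_apply _ _ _
  calc
    ∫⁻ ω, F (ω t, ω (t + 1)) ∂ζ.execMeasure =
        ∫⁻ p, G p ∂(ζ.execMeasure.map fun ω => (r ω, ω (t + 1))) := by
      rw [lintegral_map hG (by fun_prop)]; rfl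
    _ = ∫⁻ u, ∫⁻ y, G (u, y) ∂(ζ.stepKernel t u) ∂(ζ.execMeasure.map r) := by
      rw [execMeasure, ← h1, Measure.lintegral_compProd hG]
      rw [← h2]; rfl
    _ = _ := by
      rw [lintegral_map hG.lintegral_kernel_prod_right' hr]; rfl

theorem execMeasure_map_zero (ζ : M.Adversary) {V : Node S A → ℝ≥0∞} :
    ∫⁻ ω, V (ω 0) ∂ζ.execMeasure = V Node.root := by
  have hV : Measurable V := measurable_from_top
  rw [execMeasure, Kernel.lintegral_traj _ (by fun_prop)]
  have : IsProbabilityMeasure ((Kernel.traj (X := fun _ => Node S A) ζ.stepKernel 0)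
    fun _ => Node.root) := inferInstance
  simp [Function.updateFinset]

/-- A nonnegative function on the nodes that does not increase in the mean along one step does not
increase in the mean along an execution. -/
theorem lintegral_execMeasure_le (ζ : M.Adversary) {V : Node S A → ℝ≥0∞}
    (hV : ∀ n, ∫⁻ y, V y ∂(ζ.next n).toMeasure ≤ V n) (t : ℕ) :
    ∫⁻ ω, V (ω t) ∂ζ.execMeasure ≤ V Node.root := by
  have hm : Measurable V := measurable_from_top
  induction t with
  | zero => exact ζ.execMeasure_map_zero.le
  | succ t ih =>
    have h := ζ.lintegral_execMeasure_succ t (F := fun p => V p.2) (hm.comp measurable_snd)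
    have h' : ∫⁻ ω, ∫⁻ y, V y ∂(ζ.next (ω t)).toMeasure ∂ζ.execMeasure ≤
        ∫⁻ ω, V (ω t) ∂ζ.execMeasure := lintegral_mono fun ω => hV (ω t)
    exact h.le.trans (h'.trans ih)

/-- A quantity that does not decrease along one step does not decrease along an execution. -/
theorem ae_monotone (ζ : M.Adversary) {d : Node S A → ℕ}
    (hd : ∀ n, ∀ y ∈ (ζ.next n).support, d n ≤ d y) :
    ∀ᵐ ω ∂ζ.execMeasure, Monotone fun t => d (ω t) := by
  have hm : Measurable d := measurable_from_top
  have key : ∀ t, ∀ᵐ ω ∂ζ.execMeasure, d (ω t) ≤ d (ω (t + 1)) := by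
    intro t
    let s : Set (Node S A × Node S A) := {p | d p.2 < d p.1}
    have hs : MeasurableSet s := measurableSet_lt (by fun_prop) (by fun_prop)
    -- The probability of a descent at time `t` is the mean of one-step probabilities, which vanish
    -- because `s` misses the support of the step.
    have h := ζ.lintegral_execMeasure_succ t (F := s.indicator 1)
      (measurable_one.indicator hs)
    have h0 : ∀ n, ∫⁻ y, s.indicator (1 : Node S A × Node S A → ℝ≥0∞) (n, y) ∂(ζ.next n).toMeasure = 0 := by
      intro n
      rw [lintegral_eq_zero_iff measurable_from_top, Filter.EventuallyEq, ae_iff]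
      rw [PMF.toMeasure_apply_eq_zero_iff _ MeasurableSpace.measurableSet_top, Set.disjoint_left]
      intro y hy hy'
      have hn : (n, y) ∉ s := not_lt.2 (hd n y hy)
      exact hy' (Set.indicator_of_notMem hn _)
    simp only [h0, lintegral_zero] at h
    replace h := (lintegral_eq_zero_iff ((measurable_one.indicator hs).comp
      ((measurable_pi_apply t).prodMk (measurable_pi_apply (t + 1))))).1 h
    filter_upwards [h] with ω hω
    by_contra hlt
    have : (ω t, ω (t + 1)) ∈ s := not_le.1 hlt
    simp [Set.indicator_of_mem this] at hω
  filter_upwards [ae_all_iff.2 key] with ω hω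
  exact monotone_nat_of_le_succ hω

/-- Bound on the probability that `d` ever reaches `n`, by a supermartingale. -/
theorem execMeasure_exists_le (ζ : M.Adversary) {d : Node S A → ℕ} {V : Node S A → ℝ≥0∞}
    (hd : ∀ n, ∀ y ∈ (ζ.next n).support, d n ≤ d y)
    (hV : ∀ n, ∫⁻ y, V y ∂(ζ.next n).toMeasure ≤ V n) (n : ℕ) (h1 : ∀ y, n ≤ d y → 1 ≤ V y) :
    ζ.execMeasure {ω | ∃ t, n ≤ d (ω t)} ≤ V Node.root := by
  have hm : Measurable d := measurable_from_top
  have hmV : Measurable V := measurable_from_top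
  let B : ℕ → Set (ℕ → Node S A) := fun t => {ω | n ≤ d (ω t)}
  have hB : ∀ t, ζ.execMeasure (⋃ s ∈ Set.Iic t, B s) ≤ V Node.root := by
    intro t
    calc
      ζ.execMeasure (⋃ s ∈ Set.Iic t, B s) ≤ ζ.execMeasure {ω | 1 ≤ V (ω t)} := by
        -- By monotonicity, reaching `n` at some time up to `t` almost surely means being at least
        -- `n` at time `t`, so Markov's inequality at the single time `t` suffices.
        refine measure_mono_ae ?_
        filter_upwards [ζ.ae_monotone hd] with ω hω hmem
        obtain ⟨s, hs, hsB⟩ := Set.mem_iUnion₂.1 hmem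
        exact h1 _ (le_trans hsB (hω hs))
      _ ≤ ∫⁻ ω, V (ω t) ∂ζ.execMeasure := by
        have := mul_meas_ge_le_lintegral (μ := ζ.execMeasure) (f := fun ω => V (ω t))
          (by fun_prop) 1
        rwa [one_mul] at this
      _ ≤ V Node.root := ζ.lintegral_execMeasure_le hV t
  have : {ω : ℕ → Node S A | ∃ t, n ≤ d (ω t)} = ⋃ t, ⋃ s ∈ Set.Iic t, B s := by
    ext ω
    simp only [Set.mem_ofPred_eq, Set.mem_iUnion]
    exact ⟨fun ⟨t, h⟩ => ⟨t, t, Set.mem_Iic.2 le_rfl, h⟩, fun ⟨_, s, _, h⟩ => ⟨s, h⟩⟩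
  rw [this, Monotone.measure_iUnion]
  · exact iSup_le hB
  · intro a b hab
    exact Set.biUnion_subset_biUnion_left (Set.Iic_subset_Iic.2 hab)

end ProbAutomaton.Adversary

/-! ### The supermartingale of the election -/

namespace Election

open Proc Item

/-- Bound on the probability of at least `k` further draws from a state of rank `r`. -/
noncomputable def bound (r k : ℕ) : ℝ≥0∞ :=
  if k = 0 then 1 else if r = 0 then 0 else 2⁻¹ ^ (k - r)

theorem bound_le_one (r k : ℕ) : bound r k ≤ 1 := by
  unfold bound
  split_ifs
  · exact le_rfl
  · exact zero_le
  · exact pow_le_one₀ zero_le (by simp)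

theorem bound_mono {r r' : ℕ} (h : r ≤ r') (k : ℕ) : bound r k ≤ bound r' k := by
  unfold bound
  split_ifs
  · exact le_rfl
  · exact le_rfl
  · exact zero_le
  · omega
  · exact pow_le_pow_of_le_one zero_le (by simp) (by omega)

/-- The first draw lowers rank and count together, so `k - r` does not change; for `k ≤ 1` truncated
subtraction makes both sides 1. -/
theorem bound_one_two (k : ℕ) : bound 1 (k - 1) ≤ bound 2 k := by
  rcases k with _ | _ | k
  · exact bound_le_one _ _
  · simp [bound]
  · simp [bound]

/-- For `k ≥ 2` the favourable half contributes 0 and the other half gives the factor 1/2; for `k ≤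
1` both sides are 1. -/
theorem bound_zero_one (k : ℕ) : 2⁻¹ * (bound 0 (k - 1) + bound 1 (k - 1)) ≤ bound 1 k := by
  rcases k with _ | _ | k
  · simp [bound, one_add_one_eq_two, ENNReal.inv_mul_cancel]
  · simp [bound, one_add_one_eq_two, ENNReal.inv_mul_cancel]
  · simp [bound, pow_succ, mul_comm]

/-- The sum starts at an arbitrary `k`, so that the favourable draw can be put first. -/
theorem lintegral_uniform {α : Type*} [MeasurableSpace α] (f : Fin 2 → α) {V : α → ℝ≥0∞}
    (hV : Measurable V) (k : Fin 2) :
    ∫⁻ y, V y ∂((PMF.uniformOfFintype (Fin 2)).map f).toMeasure =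
      2⁻¹ * (V (f k) + V (f (k + 1))) := by
  rw [← PMF.toMeasure_map (f := f) _ measurable_from_top, lintegral_map hV measurable_from_top,
    lintegral_fintype]
  simp only [PMF.toMeasure_apply_singleton _ _ (MeasurableSet.singleton _), Fin.sum_univ_two,
    PMF.uniformOfFintype_apply, Fintype.card_fin, Nat.cast_ofNat]
  rw [mul_add, mul_comm (V _), mul_comm (V _)]
  fin_cases k
  · rfl
  · exact add_comm _ _

/-- Bound on the probability of reaching `n` draws from a node. -/
noncomputable def value (n : ℕ) (y : Node Proc Act) : ℝ≥0∞ :=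
  ⨅ (r : ℕ) (m : Multiset Item) (_ : (r, m) ∈ ranked) (_ : Net (network.automaton.state y) m),
    bound r (n - draws y)

theorem value_le {n r : ℕ} {m : Multiset Item} {y : Node Proc Act} (hm : RankLE r m)
    (hy : Net (network.automaton.state y) m) : value n y ≤ bound r (n - draws y) := by
  obtain ⟨⟨r', m'⟩, hs, hr, rfl⟩ := hm
  exact (iInf₂_le_of_le r' m' (iInf₂_le_of_le hs hy le_rfl)).trans (bound_mono hr _)

theorem one_le_value {n : ℕ} {y : Node Proc Act} (h : n ≤ draws y) : 1 ≤ value n y := by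
  refine le_iInf₂ fun r m => le_iInf₂ fun _ _ => ?_
  simp [bound, Nat.sub_eq_zero_of_le h]

theorem draws_le_child (y : Node Proc Act) (g : PMF (Act × Proc)) (μ : Act) (P : Proc) :
    draws y ≤ draws (y.child g μ P) := by
  rcases μ with _ | _ | _ | _ | _ <;> simp [draws]

theorem draws_le_next (ζ : network.automaton.Adversary) (y : Node Proc Act) :
    ∀ y' ∈ (ζ.next y).support, draws y ≤ draws y' := by
  intro y' hy'
  unfold ProbAutomaton.Adversary.next at hy'
  split at hy'
  · cases (PMF.mem_support_pure_iff _ _).1 hy'; exact le_rfl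
  · obtain ⟨a, _, rfl⟩ := (PMF.mem_support_map_iff _ _ _).1 hy'
    exact draws_le_child _ _ _ _

/-- This holds at every node, reachable or not: without a ranked description the infimum is `⊤`. The
infimum also spares a proof that the components of a state are unique. -/
theorem lintegral_value_le (ζ : network.automaton.Adversary) (n : ℕ) (y : Node Proc Act) :
    ∫⁻ y', value n y' ∂(ζ.next y).toMeasure ≤ value n y := by
  have hV : Measurable (value n) := measurable_from_top
  unfold ProbAutomaton.Adversary.next
  split
  · rw [PMF.toMeasure_pure, lintegral_dirac]
  · rename_i g hg
    refine le_iInf₂ fun r m => le_iInf₂ fun hr hy => ?_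
    have hG := Net.group (ζ.mem_trans _ _ hg) hy
    generalize hc : (fun a : Act × Proc => y.child g a.1 a.2) = c
    have hc' : ∀ μ P, c (μ, P) = y.child g μ P := by intro μ P; rw [← hc]
    clear hc
    have hd : ∀ d P, draws (c (Act.tau (some d), P)) = draws y + 1 := by
      intro d P; rw [hc']; rfl
    have hnet : ∀ {μ P m'}, Net P m' → Net (network.automaton.state (c (μ, P))) m' := by
      intro μ P m' h; rw [hc']; exact h
    cases hG with
    | msg h =>
      rw [PMF.pure_map, PMF.toMeasure_pure, lintegral_dirac]
      refine (value_le ⟨_, hr, le_rfl, rfl⟩ (hnet h)).trans_eq ?_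
      rw [hc']; rfl
    | silent hs h =>
      rw [PMF.pure_map, PMF.toMeasure_pure, lintegral_dirac]
      refine (value_le (hs.rankLE hr) (hnet h)).trans_eq ?_
      rw [hc']; rfl
    | @draw i m' T hm h =>
      subst hm
      rw [PMF.map_comp]
      have hb : ∀ k r', RankLE r' (wait i (i + k) ::ₘ m') →
          value n (c (Act.tau (some (i, i + k)), T k)) ≤ bound r' (n - draws y - 1) := by
        intro k r' h'
        have := value_le (n := n) h' (hnet (μ := Act.tau (some (i, i + k))) (h k))
        rwa [hd, ← Nat.sub_sub] at this
      have := ranked_draw _ hr i (by simp)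
      simp only [Multiset.erase_cons_head] at this
      rcases this with ⟨rfl, h2⟩ | ⟨rfl, k, h0, h1⟩
      · rw [lintegral_uniform _ hV 0]
        refine le_trans ?_ (bound_one_two _)
        refine (mul_le_mul_right (add_le_add (hb _ 1 (h2 _)) (hb _ 1 (h2 _))) _).trans_eq ?_
        rw [← two_mul, ← mul_assoc, ENNReal.inv_mul_cancel (by simp) (by simp), one_mul]
      · rw [lintegral_uniform _ hV k]
        refine le_trans ?_ (bound_zero_one _)
        exact mul_le_mul_right (add_le_add (hb _ 0 h0) (hb _ 1 h1)) _

end Election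

theorem mainTheorem3 (n : ℕ) (hn : 2 ≤ n) (ζ : Election.network.automaton.Adversary) :
    ζ.execMeasure {ω | ∃ t, n ≤ Election.draws (ω t)} ≤ 1 / 2 ^ (n - 2) := by
  refine (ζ.execMeasure_exists_le (Election.draws_le_next ζ)
    (Election.lintegral_value_le ζ n) n fun y => Election.one_le_value).trans ?_
  -- The root has rank 2 and no draws, so the bound is `2⁻¹ ^ (n - 2)`.
  refine (Election.value_le (y := Node.root) (r := 2) ⟨_, List.mem_cons_self, le_rfl, rfl⟩
    Election.net_network).trans_eq ?_
  rw [Election.draws, Election.bound, if_neg (by omega), if_neg (by omega), Nat.sub_zero, one_div,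
    ENNReal.inv_pow]
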